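/- Let $n\ge 0$. Let $\mathrm{Bord}_{n+1}$ denote the symmetric monoidal structure, under disjoint union, of closed orientable smooth $n$-manifolds and of compact orientable smooth $(n+1)$-dimensional bordisms between them, taken up to diffeomorphism preserving the boundary, with gluing of bordisms as composition (orientable means that an orientation exists; none is fixed, and a composition is considered whenever the glued manifold is again orientable). A monoidal TQFT with values in a symmetric monoidal category $(\mathcal C,\otimes,I)$ is a symmetric (strong) monoidal functor $Z:\mathrm{Bord}_{n+1}\to\mathcal C$; a closed orientable $(n+1)$-manifold $W$, seen as a bordism $\emptyset\to\emptyset$, has a value $Z(W):I\to I$. A dual of an object $c$ of $\mathcal C$ is an object $c^*$ with morphisms $\delta:I\to c^*\otimes c$ and $\mu:c\otimes c^*\to I$ satisfying the two triangle identities, and the Euler characteristic of a dualizable object $c$ is the trace of $\mathrm{id}_c$, that is, the composition $I\xrightarrow{\delta}c^*\otimes c\cong c\otimes c^*\xrightarrow{\mu}I$, where the isomorphism is the symmetry. (1) For every monoidal TQFT $Z:\mathrm{Bord}_{n+1}\to\mathcal C$ and every closed orientable $n$-manifold $M$, the object $Z(M)$ is dualizable and $Z(M\times S^1):I\to I$ is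 the Euler characteristic of $Z(M)$. (2) Let $R$ be a commutative ring whose only idempotents are $0$ and $1$, and let $\chi$ be an $R$-valued diffeomorphism invariant of closed orientable $(n+1)$-manifolds. If there is a closed orientable $n$-manifold $M$ such that $\chi(M\times S^1)$ does not lie in the subring of $R$ generated by $1$, then $\chi$ is not strongly quantizable: there is no monoidal TQFT $Z:\mathrm{Bord}_{n+1}\to R\text{-}\mathrm{Mod}$ such that, for every closed orientable $(n+1)$-manifold $W$, the map $Z(W):R\to R$ is the multiplication by $\chi(W)$. -/

import Mathlib

universe u v w

noncomputable section

namespace Bord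

section Manifolds

open Set Topology
open scoped Manifold ContDiff

/-! ### Orientability -/

section Orientable

variable {E : Type*} [NormedAddCommGroup E] [NormedSpace ℝ E]
  {H : Type*} [TopologicalSpace H]
  {E' : Type*} [NormedAddCommGroup E'] [NormedSpace ℝ E']
  {H' : Type*} [TopologicalSpace H']

/-- A smooth manifold (possibly with boundary) is orientable if its tangent spaces can be oriented
in a locally constant way. The sign of the nonzero number `σ x` is the orientation of the tangent
space at `x`, relative to the fixed orientation of the model space `E`, in the preferred chart at
`x`; the condition says that, seen in the preferred chart at `x`, the orientations at all points
`y` near `x` agree with the one at `x`. -/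
def IsOrientable (I : ModelWithCorners ℝ E H) (M : Type*) [TopologicalSpace M] [ChartedSpace H M]
    [IsManifold I ∞ M] : Prop :=
  ∃ σ : M → ℝ, ∀ x : M, ∀ᶠ y in 𝓝 x, 0 < σ x * σ y * (tangentCoordChange I y x y).det

theorem isOrientable_of_isEmpty (I : ModelWithCorners ℝ E H) (M : Type*) [TopologicalSpace M]
    [ChartedSpace H M] [IsManifold I ∞ M] [IsEmpty M] : IsOrientable I M :=
  ⟨fun _ => 1, fun x => isEmptyElim x⟩

theorem isOrientable_sum {I : ModelWithCorners ℝ E H} {M N : Type*}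
    [TopologicalSpace M] [ChartedSpace H M] [IsManifold I ∞ M]
    [TopologicalSpace N] [ChartedSpace H N] [IsManifold I ∞ N]
    (hM : IsOrientable I M) (hN : IsOrientable I N) : IsOrientable I (M ⊕ N) := by
  obtain ⟨σ, hσ⟩ := hM
  obtain ⟨τ, hτ⟩ := hN
  refine ⟨Sum.elim σ τ, ?_⟩
  rintro (x | x)
  · rw [(IsOpenEmbedding.inl (X := M) (Y := N)).map_nhds_eq x |>.symm, Filter.eventually_map]
    filter_upwards [hσ x] with y hy
    have : tangentCoordChange I (Sum.inl y : M ⊕ N) (Sum.inl x) (Sum.inl y)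
        = tangentCoordChange I y x y := by
      rw [tangentCoordChange_def, tangentCoordChange_def, extChartAt_inl_apply]
      congr 1
      ext z
      simp [extChartAt, ChartedSpace.sum_chartAt_inl, Sum.inl_injective.extend_apply]
    change 0 < σ x * σ y * (tangentCoordChange I (Sum.inl y : M ⊕ N) (Sum.inl x) (Sum.inl y)).det
    rw [this]
    exact hy
  · rw [(IsOpenEmbedding.inr (X := M) (Y := N)).map_nhds_eq x |>.symm, Filter.eventually_map]
    filter_upwards [hτ x] with y hy
    have : tangentCoordChange I (Sum.inr y : M ⊕ N) (Sum.inr x) (Sum.inr y)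
        = tangentCoordChange I y x y := by
      rw [tangentCoordChange_def, tangentCoordChange_def, extChartAt_inr_apply]
      congr 1
      ext z
      simp [extChartAt, ChartedSpace.sum_chartAt_inr, Sum.inr_injective.extend_apply]
    change 0 < τ x * τ y * (tangentCoordChange I (Sum.inr y : M ⊕ N) (Sum.inr x) (Sum.inr y)).det
    rw [this]
    exact hy

theorem fderivWithin_prodMap_aux {f : E → E} {g : E' → E'} {f' : E →L[ℝ] E} {g' : E' →L[ℝ] E'}
    {s : Set E} {t : Set E'} {a : E} {b : E'} (hf : HasFDerivWithinAt f f' s a)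
    (hg : HasFDerivWithinAt g g' t b) (hs : UniqueDiffWithinAt ℝ s a)
    (ht : UniqueDiffWithinAt ℝ t b) :
    fderivWithin ℝ (Prod.map f g) (s ×ˢ t) (a, b) = f'.prodMap g' :=
  (HasFDerivWithinAt.prodMap (s := s ×ˢ t) (a, b)
    (hf.mono (by rintro _ ⟨p, hp, rfl⟩; exact hp.1))
    (hg.mono (by rintro _ ⟨p, hp, rfl⟩; exact hp.2))).fderivWithin (hs.prod ht)

theorem isOrientable_prod [FiniteDimensional ℝ E] [FiniteDimensional ℝ E']
    {I : ModelWithCorners ℝ E H} {J : ModelWithCorners ℝ E' H'} {M N : Type*}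
    [TopologicalSpace M] [ChartedSpace H M] [IsManifold I ∞ M]
    [TopologicalSpace N] [ChartedSpace H' N] [IsManifold J ∞ N]
    (hM : IsOrientable I M) (hN : IsOrientable J N) : IsOrientable (I.prod J) (M × N) := by
  obtain ⟨σ, hσ⟩ := hM
  obtain ⟨τ, hτ⟩ := hN
  refine ⟨fun p => σ p.1 * τ p.2, ?_⟩
  rintro ⟨x, x'⟩
  have h1 : ∀ᶠ q : M × N in 𝓝 (x, x'), q.1 ∈ (extChartAt I x).source :=
    continuous_fst.continuousAt.eventually (extChartAt_source_mem_nhds (I := I) x)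
  have h2 : ∀ᶠ q : M × N in 𝓝 (x, x'), q.2 ∈ (extChartAt J x').source :=
    continuous_snd.continuousAt.eventually (extChartAt_source_mem_nhds (I := J) x')
  filter_upwards [continuous_fst.continuousAt.eventually (hσ x),
    continuous_snd.continuousAt.eventually (hτ x'), h1, h2] with ⟨y, y'⟩ hy hy' h1 h2
  have key : tangentCoordChange (I.prod J) (y, y') (x, x') (y, y') =
      (tangentCoordChange I y x y).prodMap (tangentCoordChange J y' x' y') := by
    have hd1 := hasFDerivWithinAt_tangentCoordChange (I := I) (x := y) (y := x) (z := y)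
        ⟨mem_extChartAt_source y, h1⟩
    have hd2 := hasFDerivWithinAt_tangentCoordChange (I := J) (x := y') (y := x') (z := y')
        ⟨mem_extChartAt_source y', h2⟩
    have hd := fderivWithin_prodMap_aux hd1 hd2
      (I.uniqueDiffOn _ (mem_range_self _)) (J.uniqueDiffOn _ (mem_range_self _))
    rw [← hd, tangentCoordChange_def, I.range_prod, extChartAt_prod, extChartAt_prod]
    rfl
  have hdet : (tangentCoordChange (I.prod J) (y, y') (x, x') (y, y')).det =
      (tangentCoordChange I y x y).det * (tangentCoordChange J y' x' y').det := by
    rw [key]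
    exact LinearMap.det_prodMap _ _
  have e : ∀ a b c d r s : ℝ, a * b * (c * d) * (r * s) = (a * c * r) * (b * d * s) := by
    intros; ring
  rw [hdet, e]
  exact mul_pos hy hy'

theorem det_tangentCoordChange_of_eq {I : ModelWithCorners ℝ E H} {M : Type*}
    [TopologicalSpace M] [ChartedSpace H M] [IsManifold I ∞ M] {x y : M}
    (h : extChartAt I y = extChartAt I x) : (tangentCoordChange I y x y).det = 1 := by
  have : tangentCoordChange I y x y = ContinuousLinearMap.id ℝ E := by
    ext v
    rw [tangentCoordChange_def, ← h, ← tangentCoordChange_def,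
      tangentCoordChange_self (mem_extChartAt_source y)]
    rfl
  rw [this]
  exact LinearMap.det_id

theorem isOrientable_Icc : IsOrientable (𝓡∂ 1) (Icc (0 : ℝ) 1) := by
  have hneg : ∀ u : EuclideanSpace ℝ (Fin 1), HasFDerivAt
      (fun z : EuclideanSpace ℝ (Fin 1) => (WithLp.toLp 2 fun _ => 1 - z 0 :
        EuclideanSpace ℝ (Fin 1))) (-ContinuousLinearMap.id ℝ (EuclideanSpace ℝ (Fin 1))) u := by
    intro u
    have h := (hasFDerivAt_id (𝕜 := ℝ) u).neg.const_add
      (WithLp.toLp 2 fun _ => 1 : EuclideanSpace ℝ (Fin 1))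
    refine h.congr_of_eventuallyEq (Filter.Eventually.of_forall fun z => ?_)
    ext i
    rw [Subsingleton.elim i 0]
    simp [sub_eq_add_neg]
  refine ⟨fun t => if t.val < 1 then 1 else -1, fun x => ?_⟩
  by_cases hx : x.val < 1
  · have : ∀ᶠ y : Icc (0 : ℝ) 1 in 𝓝 x, y.val < 1 :=
      continuous_subtype_val.continuousAt.eventually (eventually_lt_nhds hx)
    filter_upwards [this] with y hy
    have hc : extChartAt (𝓡∂ 1) y = extChartAt (𝓡∂ 1) x := by
      rw [extChartAt, extChartAt, Icc_chartedSpaceChartAt_of_le_top hy,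
        Icc_chartedSpaceChartAt_of_le_top hx]
    rw [det_tangentCoordChange_of_eq hc]
    simp [hx, hy]
  · have : ∀ᶠ y : Icc (0 : ℝ) 1 in 𝓝 x, 0 < y.val :=
      continuous_subtype_val.continuousAt.eventually (eventually_gt_nhds (by linarith))
    filter_upwards [this] with y hy
    by_cases hy1 : y.val < 1
    · have hd : HasFDerivWithinAt (extChartAt (𝓡∂ 1) x ∘ (extChartAt (𝓡∂ 1) y).symm)
          (-ContinuousLinearMap.id ℝ (EuclideanSpace ℝ (Fin 1))) (range (𝓡∂ 1))
          (extChartAt (𝓡∂ 1) y y) := by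
        have hval : (extChartAt (𝓡∂ 1) y y) 0 = y.val := by
          rw [extChartAt, Icc_chartedSpaceChartAt_of_le_top hy1]
          simp [IccLeftChart]
        have hfun : ∀ z : EuclideanSpace ℝ (Fin 1), z 0 < 1 → 0 ≤ z 0 →
            (extChartAt (𝓡∂ 1) x ∘ (extChartAt (𝓡∂ 1) y).symm) z =
              WithLp.toLp 2 fun _ => 1 - z 0 := by
          intro z hz hz0
          rw [extChartAt, extChartAt, Icc_chartedSpaceChartAt_of_le_top hy1,
            Icc_chartedSpaceChartAt_of_top_le (not_lt.mp hx)]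
          ext i
          rw [Subsingleton.elim i 0]
          simp [IccLeftChart, IccRightChart, modelWithCornersEuclideanHalfSpace_symm_apply,
            min_eq_left hz.le, hz0]
        refine (hneg _).hasFDerivWithinAt.congr_of_eventuallyEq ?_
          (hfun _ (hval ▸ hy1) (hval ▸ hy.le))
        have hlt : ∀ᶠ z : EuclideanSpace ℝ (Fin 1) in 𝓝[range (𝓡∂ 1)] (extChartAt (𝓡∂ 1) y y),
            z 0 < 1 := by
          refine nhdsWithin_le_nhds ?_
          have hcont : Continuous fun z : EuclideanSpace ℝ (Fin 1) => z 0 := by fun_prop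
          exact hcont.continuousAt.eventually (eventually_lt_nhds (hval.trans_lt hy1))
        filter_upwards [hlt, self_mem_nhdsWithin] with z hz hz0
        rw [range_modelWithCornersEuclideanHalfSpace] at hz0
        exact hfun z hz hz0
      have hu : UniqueDiffWithinAt ℝ (range (𝓡∂ 1)) (extChartAt (𝓡∂ 1) y y) :=
        (𝓡∂ 1).uniqueDiffOn _ (mem_range_self _)
      rw [tangentCoordChange_def, hd.fderivWithin hu]
      have hdet : (-ContinuousLinearMap.id ℝ (EuclideanSpace ℝ (Fin 1))).det = -1 := by
        change LinearMap.det (-LinearMap.id : EuclideanSpace ℝ (Fin 1) →ₗ[ℝ] _) = -1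
        rw [← neg_one_smul ℝ LinearMap.id, LinearMap.det_smul]
        simp
      rw [hdet]
      simp [hx, hy1]
    · have hc : extChartAt (𝓡∂ 1) y = extChartAt (𝓡∂ 1) x := by
        rw [extChartAt, extChartAt, Icc_chartedSpaceChartAt_of_top_le (not_lt.mp hy1),
          Icc_chartedSpaceChartAt_of_top_le (not_lt.mp hx)]
      rw [det_tangentCoordChange_of_eq hc]
      simp [hx, hy1]

end Orientable

/-! ### The circle as a manifold over the half-line

Mathlib's circle is modelled on `EuclideanSpace ℝ (Fin 1)`. To use it as a factor of a manifold
modelled on `ℝⁿ × [0, ∞)`, we give it charts with values in `[0, ∞)`, namely angle functions with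
values in `(0, 2π)`. The theorem `circle_compatible` below says that the smooth structure is the usual
one. -/

section Circle

open Complex

theorem continuous_circle_div (z : Circle) :
    Continuous fun w : Circle => ((w / z : Circle) : ℂ) := by
  have h : Continuous fun w : Circle => (w : ℂ) := continuous_subtype_val
  simpa [Circle.coe_div] using h.div_const (z : ℂ)

/-- The angle chart of the circle centered at `z`, with source the complement of `-z` and target
the interval `(0, 2π)` in the half-line. -/
def circleChart (z : Circle) : OpenPartialHomeomorph Circle (EuclideanHalfSpace 1) where
  source := {w | ((w / z : Circle) : ℂ) ∈ slitPlane}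
  target := {t | 0 < t.val 0 ∧ t.val 0 < 2 * Real.pi}
  toFun w := ⟨WithLp.toLp 2 fun _ => arg ((w / z : Circle) : ℂ) + Real.pi, by
    have := neg_pi_lt_arg ((w / z : Circle) : ℂ)
    change 0 ≤ arg ((w / z : Circle) : ℂ) + Real.pi
    linarith⟩
  invFun t := z * Circle.exp (t.val 0 - Real.pi)
  map_source' := by
    intro w hw
    have h1 := neg_pi_lt_arg ((w / z : Circle) : ℂ)
    have h2 := (arg_le_pi ((w / z : Circle) : ℂ)).lt_of_ne (mem_slitPlane_iff_arg.mp hw).1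
    change 0 < arg ((w / z : Circle) : ℂ) + Real.pi ∧
      arg ((w / z : Circle) : ℂ) + Real.pi < 2 * Real.pi
    constructor <;> linarith
  map_target' := by
    intro t ht
    change (((z * Circle.exp (t.val 0 - Real.pi)) / z : Circle) : ℂ) ∈ slitPlane
    rw [mul_div_cancel_left, mem_slitPlane_iff_arg, Circle.arg_exp (by linarith [ht.1])
      (by linarith [ht.2])]
    exact ⟨by linarith [ht.2], Circle.coe_ne_zero _⟩
  left_inv' := by
    intro w _
    change z * Circle.exp (arg ((w / z : Circle) : ℂ) + Real.pi - Real.pi) = w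
    rw [add_sub_cancel_right, Circle.exp_arg, mul_div_cancel]
  right_inv' := by
    intro t ht
    apply Subtype.ext
    ext i
    rw [Subsingleton.elim i 0]
    change arg ((z * Circle.exp (t.val 0 - Real.pi) / z : Circle) : ℂ) + Real.pi = t.val 0
    rw [mul_div_cancel_left, Circle.arg_exp (by linarith [ht.1]) (by linarith [ht.2])]
    ring
  open_source := by
    exact isOpen_slitPlane.preimage (continuous_circle_div z)
  open_target := by
    have h : Continuous fun t : EuclideanHalfSpace 1 => t.val 0 :=
      (PiLp.continuous_apply 2 _ 0).comp continuous_subtype_val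
    exact (isOpen_lt continuous_const h).inter (isOpen_lt h continuous_const)
  continuousOn_toFun := by
    refine Topology.IsInducing.subtypeVal.continuousOn_iff.mpr ?_
    refine (PiLp.continuous_toLp 2 _).comp_continuousOn (continuousOn_pi.mpr fun _ => ?_)
    refine ContinuousOn.add ?_ continuousOn_const
    intro w hw
    exact ((continuousAt_arg hw).comp (f := fun w : Circle => ((w / z : Circle) : ℂ))
      (continuous_circle_div z).continuousAt).continuousWithinAt
  continuousOn_invFun := by
    have h : Continuous fun t : EuclideanHalfSpace 1 => t.val 0 :=
      (PiLp.continuous_apply 2 _ 0).comp continuous_subtype_val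
    exact (continuous_const.mul (Circle.exp.continuous.comp
      (h.sub continuous_const))).continuousOn

instance circleChartedSpace : ChartedSpace (EuclideanHalfSpace 1) Circle where
  atlas := range circleChart
  chartAt := circleChart
  mem_chart_source z := by
    change ((z / z : Circle) : ℂ) ∈ slitPlane
    simp
  chart_mem_atlas z := mem_range_self z

/-- A transition map between angle charts, as a map of `ℝ`. -/
def circleTransition (c : ℂ) (u : EuclideanSpace ℝ (Fin 1)) : EuclideanSpace ℝ (Fin 1) :=
  WithLp.toLp 2 fun _ => (log (c * exp (((u 0 - Real.pi : ℝ) : ℂ) * I))).im + Real.pi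

theorem contDiffAt_circleTransition {c : ℂ} {u : EuclideanSpace ℝ (Fin 1)}
    (h : c * exp (((u 0 - Real.pi : ℝ) : ℂ) * I) ∈ slitPlane) :
    ContDiffAt ℝ ∞ (circleTransition c) u := by
  have h0 : ContDiff ℝ ∞ fun u : EuclideanSpace ℝ (Fin 1) =>
      c * exp (((u 0 - Real.pi : ℝ) : ℂ) * I) := by
    have : ContDiff ℝ ∞ fun u : EuclideanSpace ℝ (Fin 1) => u 0 - Real.pi := by fun_prop
    exact contDiff_const.mul ((ofRealCLM.contDiff.comp this).mul contDiff_const).cexp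
  have h1 : ContDiffAt ℝ ∞ (fun u : EuclideanSpace ℝ (Fin 1) =>
      log (c * exp (((u 0 - Real.pi : ℝ) : ℂ) * I))) u :=
    ContDiffAt.comp (g := log) u ((contDiffAt_log h).restrict_scalars ℝ) h0.contDiffAt
  have h2 : ContDiffAt ℝ ∞ (fun u : EuclideanSpace ℝ (Fin 1) =>
      (log (c * exp (((u 0 - Real.pi : ℝ) : ℂ) * I))).im + Real.pi) u :=
    (imCLM.contDiff.contDiffAt.comp u h1).add contDiffAt_const
  exact PiLp.contDiff_toLp.contDiffAt.comp u (contDiffAt_pi.mpr fun _ => h2)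

theorem hasFDerivAt_circleTransition {c : ℂ} {u : EuclideanSpace ℝ (Fin 1)}
    (h : c * exp (((u 0 - Real.pi : ℝ) : ℂ) * I) ∈ slitPlane) :
    HasFDerivAt (circleTransition c) (ContinuousLinearMap.id ℝ (EuclideanSpace ℝ (Fin 1))) u := by
  have hd : HasDerivAt (fun t : ℝ => (log (c * exp (((t - Real.pi : ℝ) : ℂ) * I))).im + Real.pi)
      1 (u 0) := by
    have h1 : HasDerivAt (fun t : ℝ => c * exp (((t - Real.pi : ℝ) : ℂ) * I))
        (c * (exp (((u 0 - Real.pi : ℝ) : ℂ) * I) * (((1 : ℝ) : ℂ) * I))) (u 0) :=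
      ((((hasDerivAt_id (u 0)).sub_const Real.pi).ofReal_comp.mul_const I).cexp).const_mul c
    have h2 := (h1.clog_real h)
    have h3 := (imCLM.hasFDerivAt.comp_hasDerivAt (u 0) h2).add_const Real.pi
    have hne := slitPlane_ne_zero h
    rw [← mul_assoc, mul_div_right_comm, div_self hne] at h3
    simpa using h3
  have hp : HasFDerivAt (fun u : EuclideanSpace ℝ (Fin 1) => u 0)
      (EuclideanSpace.proj (0 : Fin 1) : EuclideanSpace ℝ (Fin 1) →L[ℝ] ℝ) u :=
    (EuclideanSpace.proj (0 : Fin 1) : EuclideanSpace ℝ (Fin 1) →L[ℝ] ℝ).hasFDerivAt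
  rw [← hasFDerivWithinAt_univ, hasFDerivWithinAt_euclidean]
  intro i
  rw [Subsingleton.elim i 0, hasFDerivWithinAt_univ]
  refine (hd.comp_hasFDerivAt u hp).congr_fderiv ?_
  ext v
  simp

theorem extChartAt_circle (x y : Circle) {u : EuclideanSpace ℝ (Fin 1)} (hu : 0 ≤ u 0) :
    (extChartAt (𝓡∂ 1) x ∘ (extChartAt (𝓡∂ 1) y).symm) u =
      circleTransition ((y / x : Circle) : ℂ) u := by
  ext i
  change arg ((y * Circle.exp (max (u 0) 0 - Real.pi) / x : Circle) : ℂ) + Real.pi =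
    (log (((y / x : Circle) : ℂ) * exp (((u 0 - Real.pi : ℝ) : ℂ) * I))).im + Real.pi
  rw [max_eq_left hu, log_im, mul_div_right_comm, Circle.coe_mul, Circle.coe_exp]

instance isManifold_circle : IsManifold (𝓡∂ 1) ∞ Circle := by
  apply isManifold_of_contDiffOn
  rintro e e' ⟨y, rfl⟩ ⟨x, rfl⟩ u ⟨hu, hur⟩
  rw [range_modelWithCornersEuclideanHalfSpace] at hur
  have hu0 : 0 ≤ u 0 := hur
  have hs : ((y * Circle.exp (max (u 0) 0 - Real.pi) / x : Circle) : ℂ) ∈ slitPlane := hu.2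
  rw [max_eq_left hu0, mul_div_right_comm, Circle.coe_mul, Circle.coe_exp] at hs
  refine (contDiffAt_circleTransition hs).contDiffWithinAt.congr (fun z hz => ?_) ?_
  · have hz2 := hz.2
    rw [range_modelWithCornersEuclideanHalfSpace] at hz2
    exact extChartAt_circle x y hz2
  · exact extChartAt_circle x y hu0

theorem isOrientable_circle : IsOrientable (𝓡∂ 1) Circle := by
  refine ⟨fun _ => 1, fun x => ?_⟩
  filter_upwards [extChartAt_source_mem_nhds (I := 𝓡∂ 1) x] with y hy
  have h0 : (extChartAt (𝓡∂ 1) y y) 0 = Real.pi := by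
    change arg ((y / y : Circle) : ℂ) + Real.pi = Real.pi
    simp
  have hs : ((y / x : Circle) : ℂ) *
      exp ((((extChartAt (𝓡∂ 1) y y) 0 - Real.pi : ℝ) : ℂ) * I) ∈ slitPlane := by
    rw [extChartAt_source] at hy
    rw [h0]
    simpa using (show ((y / x : Circle) : ℂ) ∈ slitPlane from hy)
  have hu : UniqueDiffWithinAt ℝ (range (𝓡∂ 1)) (extChartAt (𝓡∂ 1) y y) :=
    (𝓡∂ 1).uniqueDiffOn _ (mem_range_self _)
  have hd : tangentCoordChange (𝓡∂ 1) y x y =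
      ContinuousLinearMap.id ℝ (EuclideanSpace ℝ (Fin 1)) := by
    rw [tangentCoordChange_def]
    refine HasFDerivWithinAt.fderivWithin ?_ hu
    refine (hasFDerivAt_circleTransition hs).hasFDerivWithinAt.congr (fun z hz => ?_) ?_
    · rw [range_modelWithCornersEuclideanHalfSpace] at hz
      exact extChartAt_circle x y hz
    · exact extChartAt_circle x y (by rw [h0]; exact Real.pi_pos.le)
  rw [hd, one_mul, one_mul]
  change 0 < LinearMap.det (LinearMap.id : EuclideanSpace ℝ (Fin 1) →ₗ[ℝ] _)
  simp

theorem circle_compatible : ContMDiff (𝓡 1) (𝓡∂ 1) ∞ (id : Circle → Circle) ∧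
    ContMDiff (𝓡∂ 1) (𝓡 1) ∞ (id : Circle → Circle) := by
  constructor
  · intro x
    rw [contMDiffAt_iff_target]
    refine ⟨continuousAt_id, ?_⟩
    have := finrank_real_complex_fact'
    have hcoe : ContMDiff (𝓡 1) 𝓘(ℝ, ℂ) ∞ (fun w : Circle => (w : ℂ)) := contMDiff_coe_sphere
    have h1 : ContDiffAt ℝ ∞ (fun w : ℂ => (log (w / x)).im + Real.pi) (x : ℂ) := by
      have hx : (x : ℂ) / x ∈ slitPlane := by simp
      have h2 : ContDiffAt ℝ ∞ (fun w : ℂ => w / x) (x : ℂ) := contDiffAt_id.div_const _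
      exact (imCLM.contDiff.contDiffAt.comp (x : ℂ)
        (ContDiffAt.comp (g := log) (f := fun w : ℂ => w / x) (x : ℂ) ((contDiffAt_log hx).restrict_scalars ℝ) h2)).add
        contDiffAt_const
    have h3 : ContDiffAt ℝ ∞ (fun w : ℂ => (WithLp.toLp 2 fun _ => (log (w / x)).im + Real.pi :
        EuclideanSpace ℝ (Fin 1))) (x : ℂ) :=
      PiLp.contDiff_toLp.contDiffAt.comp (x : ℂ) (contDiffAt_pi.mpr fun _ => h1)
    refine (h3.contMDiffAt.comp x hcoe.contMDiffAt).congr_of_eventuallyEq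
      (Filter.Eventually.of_forall fun w => ?_)
    ext i
    change arg ((w / x : Circle) : ℂ) + Real.pi = (log ((w : ℂ) / x)).im + Real.pi
    rw [log_im, Circle.coe_div]
  · intro x
    have h1 : ContMDiffAt (𝓡∂ 1) 𝓘(ℝ, EuclideanSpace ℝ (Fin 1)) ∞ (extChartAt (𝓡∂ 1) x) x :=
      contMDiffAt_extChartAt
    have h2 : ContDiff ℝ ∞ fun u : EuclideanSpace ℝ (Fin 1) => u 0 - Real.pi := by fun_prop
    have h3 : ContMDiffAt (𝓡∂ 1) (𝓡 1) ∞
        (fun w => x * Circle.exp ((extChartAt (𝓡∂ 1) x w) 0 - Real.pi)) x :=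
      (contMDiff_mul_left (I := 𝓡 1) (n := ∞) (a := x)).contMDiffAt.comp x
        (contMDiff_circleExp.contMDiffAt.comp x (h2.contMDiff.contMDiffAt.comp x h1))
    refine h3.congr_of_eventuallyEq (Filter.Eventually.of_forall fun w => ?_)
    change w = x * Circle.exp (arg ((w / x : Circle) : ℂ) + Real.pi - Real.pi)
    rw [add_sub_cancel_right, Circle.exp_arg, mul_div_cancel]

end Circle

/-! ### Compact orientable manifolds and bordisms -/

/-- Compact orientable smooth manifolds modelled on `I`. -/
structure CompactManifold {E H : Type} [NormedAddCommGroup E] [NormedSpace ℝ E]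
    [TopologicalSpace H] (I : ModelWithCorners ℝ E H) where
  carrier : Type
  [topologicalSpace : TopologicalSpace carrier]
  [chartedSpace : ChartedSpace H carrier]
  [isManifold : IsManifold I ∞ carrier]
  [compactSpace : CompactSpace carrier]
  [t2Space : T2Space carrier]
  orientable : IsOrientable I carrier

namespace CompactManifold

variable {E H : Type} [NormedAddCommGroup E] [NormedSpace ℝ E] [TopologicalSpace H]
  {I : ModelWithCorners ℝ E H}

instance : CoeSort (CompactManifold I) Type := ⟨carrier⟩

instance (M : CompactManifold I) : TopologicalSpace M := M.topologicalSpace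
instance (M : CompactManifold I) : ChartedSpace H M := M.chartedSpace
instance (M : CompactManifold I) : IsManifold I ∞ M := M.isManifold
instance (M : CompactManifold I) : CompactSpace M := M.compactSpace
instance (M : CompactManifold I) : T2Space M := M.t2Space

/-- Diffeomorphisms of compact manifolds. -/
abbrev Diffeo (M N : CompactManifold I) : Type := Diffeomorph I I M N ∞

/-- The identity diffeomorphism. -/
def refl (M : CompactManifold I) : Diffeo M M := Diffeomorph.refl I M ∞

/-- The empty manifold. -/
def empty (I : ModelWithCorners ℝ E H) : CompactManifold I :=
  letI : ChartedSpace H Empty := ChartedSpace.empty H Empty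
  { carrier := Empty
    orientable := isOrientable_of_isEmpty I Empty }

instance : IsEmpty (empty I) := inferInstanceAs (IsEmpty Empty)

/-- The disjoint union of two manifolds. -/
def sum (M N : CompactManifold I) : CompactManifold I where
  carrier := M ⊕ N
  orientable := isOrientable_sum M.orientable N.orientable

/-- The diffeomorphism `(M ⊔ N) ⊔ P ≅ M ⊔ (N ⊔ P)`. -/
def sumAssoc (M N P : CompactManifold I) : Diffeo ((M.sum N).sum P) (M.sum (N.sum P)) :=
  Diffeomorph.sumAssoc I M ∞ N P

/-- The diffeomorphism `M ⊔ N ≅ N ⊔ M`. -/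
def sumComm (M N : CompactManifold I) : Diffeo (M.sum N) (N.sum M) :=
  Diffeomorph.sumComm I M ∞ N

/-- The diffeomorphism `M ⊔ ∅ ≅ M`. -/
def sumEmpty (M : CompactManifold I) : Diffeo (M.sum (empty I)) M :=
  Diffeomorph.sumEmpty I M ∞

/-- The diffeomorphism `∅ ⊔ M ≅ M`. -/
def emptySum (M : CompactManifold I) : Diffeo ((empty I).sum M) M :=
  (sumComm (empty I) M).trans (sumEmpty M)

end CompactManifold

/-- The smooth maps that are injective and have injective differentials. When the source is compact
and the target is Hausdorff, as is always the case below, they are the smooth embeddings. -/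
structure IsEmbedding {E H E' H' : Type} [NormedAddCommGroup E] [NormedSpace ℝ E]
    [TopologicalSpace H] [NormedAddCommGroup E'] [NormedSpace ℝ E'] [TopologicalSpace H']
    (I : ModelWithCorners ℝ E H) (J : ModelWithCorners ℝ E' H')
    {M N : Type} [TopologicalSpace M] [ChartedSpace H M] [TopologicalSpace N] [ChartedSpace H' N]
    (f : M → N) : Prop where
  contMDiff : ContMDiff I J ∞ f
  injective : Function.Injective f
  mfderiv_injective : ∀ x, Function.Injective (mfderiv I J f x)

section IsEmbedding

variable {E H E' H' : Type} [NormedAddCommGroup E] [NormedSpace ℝ E]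
    [TopologicalSpace H] [NormedAddCommGroup E'] [NormedSpace ℝ E'] [TopologicalSpace H']
    {I : ModelWithCorners ℝ E H} {J : ModelWithCorners ℝ E' H'}
    {M N M' N' : Type} [TopologicalSpace M] [ChartedSpace H M]
    [TopologicalSpace N] [ChartedSpace H' N]
    [TopologicalSpace M'] [ChartedSpace H M'] [TopologicalSpace N'] [ChartedSpace H' N']

theorem IsEmbedding.of_leftInverse {f : M → N} {g : N → M} (hf : ContMDiff I J ∞ f)
    (hg : ContMDiff J I ∞ g) (h : Function.LeftInverse g f) : IsEmbedding I J f where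
  contMDiff := hf
  injective := h.injective
  mfderiv_injective x := by
    have hc : mfderiv I I (g ∘ f) x = (mfderiv J I g (f x)).comp (mfderiv I J f x) :=
      mfderiv_comp x (hg.mdifferentiable (by simp) (f x)) (hf.mdifferentiable (by simp) x)
    rw [h.comp_eq_id, mfderiv_id] at hc
    intro v w hvw
    have := congrArg (mfderiv J I g (f x)) hvw
    exact (congrArg (fun L => L v) hc).trans (this.trans (congrArg (fun L => L w) hc).symm)

theorem IsEmbedding.of_isEmpty [IsEmpty M] (f : M → N) : IsEmbedding I J f where
  contMDiff x := isEmptyElim x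
  injective x := isEmptyElim x
  mfderiv_injective x := isEmptyElim x

theorem IsEmbedding.sumMap {f : M → N} {g : M' → N'} (hf : IsEmbedding I J f)
    (hg : IsEmbedding I J g) : IsEmbedding I J (Sum.map f g) where
  contMDiff := hf.contMDiff.sumMap hg.contMDiff
  injective := hf.injective.sumMap hg.injective
  mfderiv_injective := by
    have hd := (hf.contMDiff.sumMap hg.contMDiff).mdifferentiable (n := ∞) (by simp)
    rintro (x | x)
    · have h1 := (hd (Sum.inl x)).hasMFDerivAt.comp x
        (hasMFDerivAt_inl (I := I) (M := M) (M' := M') (q := x) (p := Sum.inl (x)))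
      have h2 := (hasMFDerivAt_inl (I := J) (M := N) (M' := N') (q := f x) (p := Sum.inl (f x))).comp x
        (hf.contMDiff.mdifferentiable (by simp) x).hasMFDerivAt
      have h3 := hasMFDerivAt_unique h1 h2
      intro v w hvw
      apply hf.mfderiv_injective x
      exact (congrArg (fun L => L v) h3).symm.trans (Eq.trans hvw (congrArg (fun L => L w) h3))
    · have h1 := (hd (Sum.inr x)).hasMFDerivAt.comp x
        (hasMFDerivAt_inr (I := I) (M := M) (M' := M') (q' := x) (p := Sum.inr (x)))
      have h2 := (hasMFDerivAt_inr (I := J) (M := N) (M' := N') (q' := g x) (p := Sum.inr (g x))).comp x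
        (hg.contMDiff.mdifferentiable (by simp) x).hasMFDerivAt
      have h3 := hasMFDerivAt_unique h1 h2
      intro v w hvw
      apply hg.mfderiv_injective x
      exact (congrArg (fun L => L v) h3).symm.trans (Eq.trans hvw (congrArg (fun L => L w) h3))

end IsEmbedding

/-- Closed orientable smooth manifolds of dimension `n`: the objects of the bordism category. -/
abbrev ClosedManifold (n : ℕ) : Type 1 := CompactManifold (𝓡 n)

/-- The empty manifold of dimension `n`. -/
abbrev emptyManifold (n : ℕ) : ClosedManifold n := CompactManifold.empty (𝓡 n)

/-- The half-space `ℝⁿ × [0, ∞)`, as a model for manifolds with boundary of dimension `n + 1`. -/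
abbrev halfSpaceModel (n : ℕ) : ModelWithCorners ℝ
    (EuclideanSpace ℝ (Fin n) × EuclideanSpace ℝ (Fin 1))
    (ModelProd (EuclideanSpace ℝ (Fin n)) (EuclideanHalfSpace 1)) :=
  (𝓡 n).prod (𝓡∂ 1)

/-- An orientable bordism of dimension `n + 1` from `M` to `N`: a compact orientable manifold with
boundary, with embeddings of `M` and `N` that identify `M ⊔ N` with the boundary. -/
structure Bordism {n : ℕ} (M N : ClosedManifold n) extends CompactManifold (halfSpaceModel n) where
  inMap : M → carrier
  outMap : N → carrier
  isEmbedding_inMap : IsEmbedding (𝓡 n) (halfSpaceModel n) inMap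
  isEmbedding_outMap : IsEmbedding (𝓡 n) (halfSpaceModel n) outMap
  disjoint : Disjoint (range inMap) (range outMap)
  boundary_eq : (halfSpaceModel n).boundary carrier = range inMap ∪ range outMap

/-- Closed orientable manifolds of dimension `n + 1`, as compact manifolds with empty boundary. -/
structure ClosedTopManifold (n : ℕ) extends CompactManifold (halfSpaceModel n) where
  boundary_eq : (halfSpaceModel n).boundary carrier = ∅

namespace Bordism

variable {n : ℕ}

/-- The equivalence of bordisms: diffeomorphism preserving the boundary pointwise. -/
def Equivalent {M N : ClosedManifold n} (W W' : Bordism M N) : Prop :=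
  ∃ Φ : CompactManifold.Diffeo W.toCompactManifold W'.toCompactManifold,
    (∀ x, Φ (W.inMap x) = W'.inMap x) ∧ ∀ y, Φ (W.outMap y) = W'.outMap y

/-- `W` is obtained by gluing `W₁ : M₁ → M₂` and `W₂ : M₂ → M₃` along `M₂`: it is the union of
smoothly embedded copies of `W₁` and `W₂`, which meet exactly in the two copies of `M₂`, identified
with each other. Such a `W`, if any, is unique up to equivalence. -/
def IsGluing {M₁ M₂ M₃ : ClosedManifold n} (W₁ : Bordism M₁ M₂) (W₂ : Bordism M₂ M₃)
    (W : Bordism M₁ M₃) : Prop :=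
  ∃ (j₁ : W₁.carrier → W.carrier) (j₂ : W₂.carrier → W.carrier),
    IsEmbedding (halfSpaceModel n) (halfSpaceModel n) j₁ ∧
    IsEmbedding (halfSpaceModel n) (halfSpaceModel n) j₂ ∧
    (∀ x, j₁ (W₁.inMap x) = W.inMap x) ∧
    (∀ z, j₂ (W₂.outMap z) = W.outMap z) ∧
    (∀ y, j₁ (W₁.outMap y) = j₂ (W₂.inMap y)) ∧
    range j₁ ∪ range j₂ = univ ∧
    range j₁ ∩ range j₂ = range (fun y => j₁ (W₁.outMap y))

/-- The mapping cylinder of a diffeomorphism `f : M ≅ N`: the cylinder `M × [0, 1]`, with `x` in `M`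
identified with `(x, 0)` and `f x` in `N` identified with `(x, 1)`. -/
def cylinder {M N : ClosedManifold n} (f : CompactManifold.Diffeo M N) : Bordism M N where
  carrier := M × Icc (0 : ℝ) 1
  orientable := isOrientable_prod M.orientable isOrientable_Icc
  inMap x := (x, 0)
  outMap y := (f.symm y, 1)
  isEmbedding_inMap := .of_leftInverse (contMDiff_id.prodMk contMDiff_const) contMDiff_fst
    fun _ => rfl
  isEmbedding_outMap := .of_leftInverse (f.symm.contMDiff.prodMk contMDiff_const)
    (f.contMDiff.comp contMDiff_fst) fun y => f.apply_symm_apply y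
  disjoint := by
    rw [Set.disjoint_left]
    rintro _ ⟨x, rfl⟩ ⟨y, hy⟩
    exact one_ne_zero (congrArg Prod.snd hy)
  boundary_eq := by
    rw [boundary_product]
    ext ⟨x, t⟩
    constructor
    · rintro ⟨-, rfl | rfl⟩
      · exact Or.inl ⟨x, rfl⟩
      · exact Or.inr ⟨f x, Prod.ext (f.symm_apply_apply x) rfl⟩
    · rintro (⟨y, hy⟩ | ⟨y, hy⟩)
      · exact ⟨trivial, Or.inl (congrArg Prod.snd hy).symm⟩
      · exact ⟨trivial, Or.inr (congrArg Prod.snd hy).symm⟩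

/-- The disjoint union of two bordisms. -/
def sum {M M' N N' : ClosedManifold n} (W : Bordism M N) (W' : Bordism M' N') :
    Bordism (M.sum M') (N.sum N') where
  toCompactManifold := W.toCompactManifold.sum W'.toCompactManifold
  inMap := Sum.map W.inMap W'.inMap
  outMap := Sum.map W.outMap W'.outMap
  isEmbedding_inMap := W.isEmbedding_inMap.sumMap W'.isEmbedding_inMap
  isEmbedding_outMap := W.isEmbedding_outMap.sumMap W'.isEmbedding_outMap
  disjoint := by
    rw [Set.disjoint_left]
    rintro _ ⟨x | x, rfl⟩ ⟨y | y, hy⟩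
    · exact Set.disjoint_left.mp W.disjoint ⟨x, rfl⟩ ⟨y, Sum.inl_injective hy⟩
    · exact Sum.inr_ne_inl hy
    · exact Sum.inl_ne_inr hy
    · exact Set.disjoint_left.mp W'.disjoint ⟨x, rfl⟩ ⟨y, Sum.inr_injective hy⟩
  boundary_eq := by
    refine (ModelWithCorners.boundary_disjointUnion (I := halfSpaceModel n)
      (M := W.carrier) (M' := W'.carrier)).trans ?_
    rw [W.boundary_eq, W'.boundary_eq]
    ext p
    constructor
    · rintro (⟨_, ⟨x, rfl⟩ | ⟨x, rfl⟩, rfl⟩ | ⟨_, ⟨x, rfl⟩ | ⟨x, rfl⟩, rfl⟩)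
      · exact Or.inl ⟨Sum.inl x, rfl⟩
      · exact Or.inr ⟨Sum.inl x, rfl⟩
      · exact Or.inl ⟨Sum.inr x, rfl⟩
      · exact Or.inr ⟨Sum.inr x, rfl⟩
    · rintro (⟨x | x, rfl⟩ | ⟨x | x, rfl⟩)
      · exact Or.inl ⟨_, Or.inl ⟨x, rfl⟩, rfl⟩
      · exact Or.inr ⟨_, Or.inl ⟨x, rfl⟩, rfl⟩
      · exact Or.inl ⟨_, Or.inr ⟨x, rfl⟩, rfl⟩
      · exact Or.inr ⟨_, Or.inr ⟨x, rfl⟩, rfl⟩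

end Bordism

/-- A closed manifold of dimension `n + 1`, seen as a bordism from the empty manifold to itself. -/
def ClosedTopManifold.toBordism {n : ℕ} (W : ClosedTopManifold n) :
    Bordism (emptyManifold n) (emptyManifold n) where
  toCompactManifold := W.toCompactManifold
  inMap := isEmptyElim
  outMap := isEmptyElim
  isEmbedding_inMap := .of_isEmpty _
  isEmbedding_outMap := .of_isEmpty _
  disjoint := by simp [range_eq_empty]
  boundary_eq := by simp [range_eq_empty, W.boundary_eq]

theorem boundary_circle : (𝓡∂ 1).boundary Circle = ∅ := by
  ext z
  rw [mem_empty_iff_false, iff_false]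
  intro hz
  have h : extChartAt (𝓡∂ 1) z z ∈ frontier (range (𝓡∂ 1)) := hz
  rw [frontier_range_modelWithCornersEuclideanHalfSpace] at h
  have h1 : (0 : ℝ) = Complex.arg ((z / z : Circle) : ℂ) + Real.pi := h
  rw [div_self', Circle.coe_one, Complex.arg_one, zero_add] at h1
  exact Real.pi_pos.ne h1

/-- The product `M × S¹`. -/
def timesCircle {n : ℕ} (M : ClosedManifold n) : ClosedTopManifold n where
  carrier := M × Circle
  orientable := isOrientable_prod M.orientable isOrientable_circle
  boundary_eq := by
    rw [ModelWithCorners.boundary_of_boundaryless_left, boundary_circle]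
    exact Set.prod_empty

end Manifolds

/-! ### Topological quantum field theories -/

section TQFT

open CategoryTheory MonoidalCategory

/-- A monoidal TQFT of dimension `n + 1` with values in `C`: a symmetric (strong) monoidal functor
from the category of orientable bordisms of dimension `n + 1` to `C`. Functors are given by their
values on bordisms, which have to be invariant under equivalence, compatible with gluing whenever
the glued manifold is a bordism between orientable manifolds that is itself orientable, and equal
to the identity on cylinders. The associativity, unit and symmetry isomorphisms of the disjoint
union are the mapping cylinders of the evident diffeomorphisms. -/
structure MonoidalTQFT (n : ℕ) (C : Type u) [Category.{v} C] [MonoidalCategory C]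
    [SymmetricCategory C] where
  obj : ClosedManifold n → C
  map : ∀ {M N : ClosedManifold n}, Bordism M N → (obj M ⟶ obj N)
  map_equivalent : ∀ {M N : ClosedManifold n} {W W' : Bordism M N},
    W.Equivalent W' → map W = map W'
  map_id : ∀ M : ClosedManifold n,
    map (Bordism.cylinder (CompactManifold.refl M)) = 𝟙 (obj M)
  map_glue : ∀ {M₁ M₂ M₃ : ClosedManifold n} {W₁ : Bordism M₁ M₂} {W₂ : Bordism M₂ M₃}
    {W : Bordism M₁ M₃}, Bordism.IsGluing W₁ W₂ W → map W = map W₁ ≫ map W₂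
  /-- The compatibility with the monoidal units. -/
  ε : 𝟙_ C ≅ obj (emptyManifold n)
  /-- The compatibility with the monoidal products. -/
  μ : ∀ M N : ClosedManifold n, obj M ⊗ obj N ≅ obj (M.sum N)
  μ_natural : ∀ {M M' N N' : ClosedManifold n} (W : Bordism M N) (W' : Bordism M' N'),
    (map W ⊗ₘ map W') ≫ (μ N N').hom = (μ M M').hom ≫ map (W.sum W')
  associativity : ∀ M N P : ClosedManifold n,
    (μ M N).hom ▷ obj P ≫ (μ (M.sum N) P).hom ≫ map (Bordism.cylinder (M.sumAssoc N P)) =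
      (α_ (obj M) (obj N) (obj P)).hom ≫ obj M ◁ (μ N P).hom ≫ (μ M (N.sum P)).hom
  left_unitality : ∀ M : ClosedManifold n,
    (λ_ (obj M)).hom = ε.hom ▷ obj M ≫ (μ (emptyManifold n) M).hom ≫
      map (Bordism.cylinder M.emptySum)
  right_unitality : ∀ M : ClosedManifold n,
    (ρ_ (obj M)).hom = obj M ◁ ε.hom ≫ (μ M (emptyManifold n)).hom ≫
      map (Bordism.cylinder M.sumEmpty)
  braided : ∀ M N : ClosedManifold n,
    (μ M N).hom ≫ map (Bordism.cylinder (M.sumComm N)) =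
      (β_ (obj M) (obj N)).hom ≫ (μ N M).hom

/-- The value `Z(W) : I ⟶ I` of a TQFT on a closed manifold `W`, seen as a bordism from the empty
manifold to itself. -/
def MonoidalTQFT.value {n : ℕ} {C : Type u} [Category.{v} C] [MonoidalCategory C]
    [SymmetricCategory C] (Z : MonoidalTQFT n C) (W : ClosedTopManifold n) : 𝟙_ C ⟶ 𝟙_ C :=
  Z.ε.hom ≫ Z.map W.toBordism ≫ Z.ε.inv

/-! ### Traces and Euler characteristics -/

section Trace

variable {C : Type u} [Category.{v} C] [MonoidalCategory C] [SymmetricCategory C]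

/-- The trace of an endomorphism `f` of `c`, computed with the dual `c'` of `c`, with coevaluation
`δ : I ⟶ c' ⊗ c` and evaluation `c ⊗ c' ⟶ I`. -/
def trace (c c' : C) [ExactPairing c' c] (f : c ⟶ c) : 𝟙_ C ⟶ 𝟙_ C :=
  η_ c' c ≫ c' ◁ f ≫ (β_ c' c).hom ≫ ε_ c' c

/-- The Euler characteristic of `c`, computed with the dual `c'` of `c`. -/
def eulerCharacteristic (c c' : C) [ExactPairing c' c] : 𝟙_ C ⟶ 𝟙_ C := trace c c' (𝟙 c)

end Trace

/-! ### Quantization of invariants -/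

/-- A `Λ`-valued diffeomorphism invariant of closed orientable manifolds of dimension `n + 1`. -/
structure DiffeoInvariant (n : ℕ) (Λ : Type w) where
  toFun : ClosedTopManifold n → Λ
  invariant : ∀ W W' : ClosedTopManifold n,
    Nonempty (CompactManifold.Diffeo W.toCompactManifold W'.toCompactManifold) →
      toFun W = toFun W'

instance {n : ℕ} {Λ : Type w} : CoeFun (DiffeoInvariant n Λ) (fun _ => ClosedTopManifold n → Λ) :=
  ⟨DiffeoInvariant.toFun⟩

/-- The invariant `χ` is strongly quantizable in `C`, with respect to an inclusion `ι` of its set of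
values into the endomorphisms of the unit of `C`. -/
def StronglyQuantizableIn {n : ℕ} {Λ : Type w} (C : Type u) [Category.{v} C] [MonoidalCategory C]
    [SymmetricCategory C] (ι : Λ ↪ (𝟙_ C ⟶ 𝟙_ C)) (χ : DiffeoInvariant n Λ) : Prop :=
  ∃ Z : MonoidalTQFT n C, ∀ W : ClosedTopManifold n, Z.value W = ι (χ W)

/-- The inclusion of `R` into the endomorphisms of the unit `R` of the category of `R`-modules, which
sends `r` to the multiplication by `r`. -/
def scalarEmbedding (R : Type u) [CommRing R] :
    R ↪ (𝟙_ (ModuleCat.{u} R) ⟶ 𝟙_ (ModuleCat.{u} R)) where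
  toFun r := ModuleCat.ofHom (LinearMap.mulLeft R r)
  inj' r s h := by
    have := congrArg (fun f => f.hom (1 : R)) h
    simpa using this

/-- An invariant with values in a commutative ring `R` is strongly quantizable if it is so in the
category of `R`-modules. -/
def StronglyQuantizable {n : ℕ} {R : Type u} [CommRing R] (χ : DiffeoInvariant n R) : Prop :=
  StronglyQuantizableIn (ModuleCat.{u} R) (scalarEmbedding R) χ

end TQFT

end Bord

end

/-!
The proof of the first part is the cobordism calculus of a circle. The cylinder `M × [0, 1]`, read
with both ends outgoing or with both ends incoming, is a bordism `cup M : ∅ → M ⊔ M` or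
`cap M : M ⊔ M → ∅`. The two zigzags formed of a cup and a cap are again cylinders over `M`
(`isGluing_zigzag_left`, `isGluing_zigzag_right`), so a TQFT `Z` sends the cup and the cap to a
coevaluation and an evaluation that make `Z(M)` its own dual (`MonoidalTQFT.exactPairing`). The cup
followed by the exchange of the two copies of `M` and by the cap is `M × S¹`, cut along two opposite
points of the circle (`isGluing_cup_cap`), and its value is by definition the Euler characteristic
for this dual; any other dual gives the same one (`eulerCharacteristic_eq`).

No general collar theorem is needed. A gluing is given by two embeddings in an explicit manifold,
and every bordism that occurs is built from cylinders, so that all embeddings are affine in the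
coordinate of `[0, 1]`, or send it to an arc of the circle. To compose with the associativity and
symmetry isomorphisms, which are mapping cylinders, it is enough to exhibit an affine collar
(`HasInCollar`).

For the second part, a dual of an `R`-module `P` amounts to finitely many `pᵢ ∈ P` and linear
functionals `fᵢ` with `p = ∑ fᵢ(p) pᵢ`; the matrix `E = (fⱼ(pᵢ))` is idempotent and the Euler
characteristic is its trace. The polynomial `φ(a) = det (1 + (a - 1) E)` satisfies
`φ(a) φ(b) = φ(a b)` and `φ(1) = 1`, hence its coefficients are orthogonal idempotents with sum `1`.
If `R` has only trivial idempotents, `φ = X ^ k` and the trace, which is `φ'(1)`, is the integer `k`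
(`exists_trace_eq_natCast`).
-/

noncomputable section

namespace Bord

section Geometry

open Set Topology
open scoped Manifold ContDiff

/-! ### Immersions and embeddings -/

section Immersion

variable {E H E' H' E'' H'' : Type} [NormedAddCommGroup E] [NormedSpace ℝ E]
  [TopologicalSpace H] [NormedAddCommGroup E'] [NormedSpace ℝ E'] [TopologicalSpace H']
  [NormedAddCommGroup E''] [NormedSpace ℝ E''] [TopologicalSpace H'']
  {I : ModelWithCorners ℝ E H} {J : ModelWithCorners ℝ E' H'} {K : ModelWithCorners ℝ E'' H''}
  {M N P : Type} [TopologicalSpace M] [ChartedSpace H M]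
  [TopologicalSpace N] [ChartedSpace H' N] [TopologicalSpace P] [ChartedSpace H'' P]

/-- The map `f` is smooth at `x` and its differential at `x` is injective. -/
def ImmersiveAt (I : ModelWithCorners ℝ E H) (J : ModelWithCorners ℝ E' H') (f : M → N) (x : M) :
    Prop :=
  ContMDiffAt I J ∞ f x ∧ Function.Injective (mfderiv I J f x)

theorem ImmersiveAt.mdifferentiableAt {f : M → N} {x : M} (h : ImmersiveAt I J f x) :
    MDifferentiableAt I J f x :=
  h.1.mdifferentiableAt (by simp)

theorem ImmersiveAt.comp {g : N → P} {f : M → N} {x : M} (hg : ImmersiveAt J K g (f x))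
    (hf : ImmersiveAt I J f x) : ImmersiveAt I K (g ∘ f) x := by
  refine ⟨hg.1.comp x hf.1, ?_⟩
  rw [mfderiv_comp x hg.mdifferentiableAt hf.mdifferentiableAt]
  exact hg.2.comp hf.2

/-- A map that becomes immersive after composition with a smooth map is immersive. -/
theorem ImmersiveAt.of_comp {g : N → P} {f : M → N} {x : M} (h : ImmersiveAt I K (g ∘ f) x)
    (hg : ContMDiffAt J K ∞ g (f x)) (hf : ContMDiffAt I J ∞ f x) : ImmersiveAt I J f x := by
  refine ⟨hf, ?_⟩
  have h2 := h.2
  rw [mfderiv_comp x (hg.mdifferentiableAt (by simp)) (hf.mdifferentiableAt (by simp))] at h2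
  exact Function.Injective.of_comp (f := mfderiv J K g (f x)) h2

theorem ImmersiveAt.congr {f g : M → N} {x : M} (h : ImmersiveAt I J f x) (hfg : g =ᶠ[𝓝 x] f) :
    ImmersiveAt I J g x := by
  refine ⟨h.1.congr_of_eventuallyEq hfg, ?_⟩
  have hd := h.mdifferentiableAt.hasMFDerivAt.congr_of_eventuallyEq hfg
  rw [hd.mfderiv]
  exact h.2

theorem immersiveAt_id (x : M) : ImmersiveAt I I (id : M → M) x :=
  ⟨contMDiffAt_id, by rw [mfderiv_id]; exact Function.injective_id⟩

/-- Being an immersion at `x` may be checked after composition with a local diffeomorphism `φ`,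
whose local inverse near `x` is `r`. -/
theorem ImmersiveAt.of_localInverse {f : N → P} {φ : M → N} {r : N → M} {x : N}
    (hf : ImmersiveAt I K (f ∘ φ) (r x)) (hr : ContMDiffAt J I ∞ r x)
    (hφ : ContMDiffAt I J ∞ φ (r x)) (h : φ ∘ r =ᶠ[𝓝 x] id) : ImmersiveAt J K f x := by
  have h1 : ImmersiveAt J I r x := ((immersiveAt_id x).congr h).of_comp hφ hr
  refine (hf.comp h1).congr ?_
  filter_upwards [h] with y hy
  exact congrArg f hy.symm

theorem isEmbedding_iff {f : M → N} :
    IsEmbedding I J f ↔ Function.Injective f ∧ ∀ x, ImmersiveAt I J f x :=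
  ⟨fun h => ⟨h.injective, fun x => ⟨h.contMDiff x, h.mfderiv_injective x⟩⟩,
    fun h => ⟨fun x => (h.2 x).1, h.1, fun x => (h.2 x).2⟩⟩

theorem IsEmbedding.immersiveAt {f : M → N} (hf : IsEmbedding I J f) (x : M) :
    ImmersiveAt I J f x :=
  (isEmbedding_iff.mp hf).2 x

theorem IsEmbedding.comp {g : N → P} {f : M → N} (hg : IsEmbedding J K g)
    (hf : IsEmbedding I J f) : IsEmbedding I K (g ∘ f) :=
  isEmbedding_iff.mpr ⟨hg.injective.comp hf.injective,
    fun x => (hg.immersiveAt _).comp (hf.immersiveAt x)⟩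

theorem isEmbedding_id : IsEmbedding I I (id : M → M) :=
  isEmbedding_iff.mpr ⟨Function.injective_id, immersiveAt_id⟩

theorem isEmbedding_diffeomorph (f : Diffeomorph I J M N ∞) : IsEmbedding I J f :=
  .of_leftInverse f.contMDiff f.symm.contMDiff f.symm_apply_apply

end Immersion

section Prod

variable {E₁ H₁ E₂ H₂ E₃ H₃ E₄ H₄ : Type}
  [NormedAddCommGroup E₁] [NormedSpace ℝ E₁] [TopologicalSpace H₁]
  [NormedAddCommGroup E₂] [NormedSpace ℝ E₂] [TopologicalSpace H₂]
  [NormedAddCommGroup E₃] [NormedSpace ℝ E₃] [TopologicalSpace H₃]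
  [NormedAddCommGroup E₄] [NormedSpace ℝ E₄] [TopologicalSpace H₄]
  {I₁ : ModelWithCorners ℝ E₁ H₁} {I₂ : ModelWithCorners ℝ E₂ H₂}
  {I₃ : ModelWithCorners ℝ E₃ H₃} {I₄ : ModelWithCorners ℝ E₄ H₄}
  {M₁ M₂ M₃ M₄ : Type} [TopologicalSpace M₁] [ChartedSpace H₁ M₁]
  [TopologicalSpace M₂] [ChartedSpace H₂ M₂] [TopologicalSpace M₃] [ChartedSpace H₃ M₃]
  [TopologicalSpace M₄] [ChartedSpace H₄ M₄]

theorem IsEmbedding.prodMap {f : M₁ → M₂} {g : M₃ → M₄} (hf : IsEmbedding I₁ I₂ f)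
    (hg : IsEmbedding I₃ I₄ g) : IsEmbedding (I₁.prod I₃) (I₂.prod I₄) (Prod.map f g) where
  contMDiff := hf.contMDiff.prodMap hg.contMDiff
  injective := hf.injective.prodMap hg.injective
  mfderiv_injective := by
    rintro ⟨x, y⟩
    rw [mfderiv_prodMap (hf.immersiveAt x).mdifferentiableAt (hg.immersiveAt y).mdifferentiableAt]
    exact (hf.mfderiv_injective x).prodMap (hg.mfderiv_injective y)

end Prod

/-- The map on `(A ⊔ B) × L` that is `f` on `A × L` and `g` on `B × L`. -/
def sumProdElim {A B L P : Type} (f : A × L → P) (g : B × L → P) (p : (A ⊕ B) × L) : P :=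
  Sum.elim (fun a => f (a, p.2)) (fun b => g (b, p.2)) p.1

theorem range_sumProdElim {A B L P : Type} (f : A × L → P) (g : B × L → P) :
    range (sumProdElim f g) = range f ∪ range g := by
  ext p
  simp [sumProdElim]

section Sum

variable {E H E' H' E'' H'' : Type} [NormedAddCommGroup E] [NormedSpace ℝ E]
  [TopologicalSpace H] [NormedAddCommGroup E'] [NormedSpace ℝ E'] [TopologicalSpace H']
  [NormedAddCommGroup E''] [NormedSpace ℝ E''] [TopologicalSpace H'']
  {I : ModelWithCorners ℝ E H} {J : ModelWithCorners ℝ E' H'} {K : ModelWithCorners ℝ E'' H''}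
  {A B L P : Type} [TopologicalSpace A] [ChartedSpace H A] [TopologicalSpace B] [ChartedSpace H B]
  [TopologicalSpace L] [ChartedSpace H' L] [TopologicalSpace P] [ChartedSpace H'' P]

theorem isEmbedding_inl : IsEmbedding I I (Sum.inl : A → A ⊕ B) :=
  isEmbedding_iff.mpr ⟨Sum.inl_injective, fun x =>
    -- the constant map on `B` is irrelevant near the points of `A`
    (immersiveAt_id (I := I) x).of_comp (f := Sum.inl) (g := Sum.elim id fun _ : B => x)
      (contMDiff_id.sumElim contMDiff_const _) (ContMDiff.inl x)⟩

theorem isEmbedding_inr : IsEmbedding I I (Sum.inr : B → A ⊕ B) :=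
  isEmbedding_iff.mpr ⟨Sum.inr_injective, fun x =>
    (immersiveAt_id (I := I) x).of_comp (f := Sum.inr) (g := Sum.elim (fun _ : A => x) id)
      (contMDiff_const.sumElim contMDiff_id _) (ContMDiff.inr x)⟩

theorem IsEmbedding.sumElim {f : A → P} {g : B → P} (hf : IsEmbedding I K f)
    (hg : IsEmbedding I K g) (h : Disjoint (range f) (range g)) : IsEmbedding I K (Sum.elim f g) := by
  refine isEmbedding_iff.mpr ⟨hf.injective.sumElim hg.injective fun a b hab =>
    Set.disjoint_left.mp h ⟨a, rfl⟩ ⟨b, hab.symm⟩, ?_⟩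
  rintro (x | x)
  · refine .of_localInverse (φ := Sum.inl) (r := Sum.elim id fun _ : B => x)
      (hf.immersiveAt x) (contMDiff_id.sumElim contMDiff_const _) (ContMDiff.inl _) ?_
    filter_upwards [(IsOpenEmbedding.inl (X := A) (Y := B)).isOpen_range.mem_nhds ⟨x, rfl⟩]
    rintro _ ⟨y, rfl⟩
    rfl
  · refine .of_localInverse (φ := Sum.inr) (r := Sum.elim (fun _ : A => x) id)
      (hg.immersiveAt x) (contMDiff_const.sumElim contMDiff_id _) (ContMDiff.inr _) ?_
    filter_upwards [(IsOpenEmbedding.inr (X := A) (Y := B)).isOpen_range.mem_nhds ⟨x, rfl⟩]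
    rintro _ ⟨y, rfl⟩
    rfl

theorem IsEmbedding.sumProdElim
    {f : A × L → P} {g : B × L → P} (hf : IsEmbedding (I.prod J) K f)
    (hg : IsEmbedding (I.prod J) K g) (h : Disjoint (range f) (range g)) :
    IsEmbedding (I.prod J) K (sumProdElim f g) := by
  refine isEmbedding_iff.mpr ⟨?_, ?_⟩
  · rintro ⟨a | a, s⟩ ⟨b | b, t⟩ hab
    · have := hf.injective hab
      grind
    · exact (Set.disjoint_left.mp h ⟨_, rfl⟩ ⟨_, hab.symm⟩).elim
    · exact (Set.disjoint_left.mp h ⟨_, rfl⟩ ⟨_, hab⟩).elim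
    · have := hg.injective hab
      grind
  rintro ⟨x | x, t⟩
  · refine .of_localInverse (φ := Prod.map Sum.inl id)
      (r := Prod.map (Sum.elim id fun _ : B => x) id)
      (hf.immersiveAt (x, t)) ((contMDiff_id.sumElim contMDiff_const).prodMap contMDiff_id _)
      (ContMDiff.inl.prodMap contMDiff_id _) ?_
    have ho := (IsOpenEmbedding.inl (X := A) (Y := B)).isOpen_range.preimage
      (continuous_fst (Y := L))
    filter_upwards [ho.mem_nhds (show (Sum.inl x, t) ∈ _ from ⟨x, rfl⟩)]
    rintro ⟨_, s⟩ ⟨y, rfl⟩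
    rfl
  · refine .of_localInverse (φ := Prod.map Sum.inr id)
      (r := Prod.map (Sum.elim (fun _ : A => x) id) id)
      (hg.immersiveAt (x, t)) ((contMDiff_const.sumElim contMDiff_id).prodMap contMDiff_id _)
      (ContMDiff.inr.prodMap contMDiff_id _) ?_
    have ho := (IsOpenEmbedding.inr (X := A) (Y := B)).isOpen_range.preimage
      (continuous_fst (Y := L))
    filter_upwards [ho.mem_nhds (show (Sum.inr x, t) ∈ _ from ⟨x, rfl⟩)]
    rintro ⟨_, s⟩ ⟨y, rfl⟩
    rfl

end Sum

/-! ### Segments in the interval and arcs in the circle -/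

section Curves

theorem injective_of_apply_ne_zero {V : Type} [NormedAddCommGroup V] [NormedSpace ℝ V]
    (L : EuclideanSpace ℝ (Fin 1) →L[ℝ] V) {v : EuclideanSpace ℝ (Fin 1)} (h : L v ≠ 0) :
    Function.Injective L := by
  have hv : v ≠ 0 := fun h0 => h (by rw [h0, map_zero])
  refine (injective_iff_map_eq_zero L).mpr fun w hw => ?_
  obtain ⟨c, rfl⟩ := exists_smul_eq_of_finrank_eq_one
    (finrank_euclideanSpace_fin (𝕜 := ℝ) (n := 1)) hv w
  rw [map_smul, smul_eq_zero] at hw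
  rw [hw.resolve_right h, zero_smul]

/-- A curve in a vector space is an immersion of the interval where its derivative is not zero. -/
theorem immersiveAt_comp_val {V : Type} [NormedAddCommGroup V] [NormedSpace ℝ V] {g : ℝ → V}
    {v : V} (hg : ContDiff ℝ ∞ g) (t : Icc (0 : ℝ) 1) (hd : HasDerivAt g v t) (hv : v ≠ 0) :
    ImmersiveAt (𝓡∂ 1) 𝓘(ℝ, V) (fun s : Icc (0 : ℝ) 1 => g s) t := by
  have h1 : ContMDiff (𝓡∂ 1) 𝓘(ℝ, ℝ) ∞ (fun s : Icc (0 : ℝ) 1 => (s : ℝ)) :=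
    contMDiff_subtypeVal_Icc
  have h2 : ContMDiff 𝓘(ℝ, ℝ) 𝓘(ℝ, V) ∞ g := hg.contMDiff
  refine ⟨(h2.comp h1) t, injective_of_apply_ne_zero (V := V) _
    (v := (1 : TangentSpace (𝓡∂ 1) t)) ?_⟩
  have hc := mfderiv_comp (g := g) (f := fun s : Icc (0 : ℝ) 1 => (s : ℝ)) t
    (h2.mdifferentiable (by simp) _) (h1.mdifferentiable (by simp) t)
  have h3 := congrArg (fun L => L 1) hc
  have h4 : mfderiv 𝓘(ℝ, ℝ) 𝓘(ℝ, V) g (t : ℝ)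
      (mfderiv (𝓡∂ 1) 𝓘(ℝ, ℝ) (fun s : Icc (0 : ℝ) 1 => (s : ℝ)) t 1) = v := by
    erw [mfderiv_subtypeVal_Icc_one, mfderiv_eq_fderiv]
    exact hd.deriv
  exact fun h0 => hv (h4.symm.trans (h3.symm.trans h0))

/-- The affine path from `p` to `q` in the interval. -/
def segmentMap (p q t : Icc (0 : ℝ) 1) : Icc (0 : ℝ) 1 :=
  ⟨(1 - t) * p + t * q, convex_Icc (0 : ℝ) 1 p.2 q.2 (sub_nonneg.mpr t.2.2) t.2.1 (by ring)⟩

theorem coe_segmentMap (p q t : Icc (0 : ℝ) 1) :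
    (segmentMap p q t : ℝ) = (1 - t) * p + t * q := rfl

@[simp]
theorem segmentMap_zero (p q : Icc (0 : ℝ) 1) : segmentMap p q 0 = p := by
  ext; simp [coe_segmentMap]

@[simp]
theorem segmentMap_one (p q : Icc (0 : ℝ) 1) : segmentMap p q 1 = q := by
  ext; simp [coe_segmentMap]

theorem range_segmentMap (p q : Icc (0 : ℝ) 1) : range (segmentMap p q) = uIcc p q := by
  ext t
  rw [mem_uIcc]
  constructor
  · rintro ⟨s, rfl⟩
    obtain ⟨s, hs0, hs1⟩ := s
    rcases le_total p q with h | h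
    · left
      have h' : (p : ℝ) ≤ q := h
      constructor <;> rw [← Subtype.coe_le_coe, coe_segmentMap] <;> dsimp only <;> nlinarith
    · right
      have h' : (q : ℝ) ≤ p := h
      constructor <;> rw [← Subtype.coe_le_coe, coe_segmentMap] <;> dsimp only <;> nlinarith
  · intro ht
    by_cases hpq : p = q
    · subst hpq
      exact ⟨0, by rw [segmentMap_zero]; exact le_antisymm (by tauto) (by tauto)⟩
    have hne : (q : ℝ) - p ≠ 0 := sub_ne_zero.mpr fun e => hpq (Subtype.ext e.symm)
    refine ⟨⟨(t - p) / (q - p), ?_⟩, Subtype.ext ?_⟩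
    · rcases ht with ⟨h1, h2⟩ | ⟨h1, h2⟩
      · have h1' : (p : ℝ) ≤ t := h1
        have h2' : (t : ℝ) ≤ q := h2
        exact ⟨div_nonneg (by linarith) (by linarith),
          div_le_one_of_le₀ (by linarith) (by linarith)⟩
      · have h1' : (q : ℝ) ≤ t := h1
        have h2' : (t : ℝ) ≤ p := h2
        exact ⟨div_nonneg_of_nonpos (by linarith) (by linarith),
          div_le_one_of_ge (by linarith) (by linarith)⟩
    · rw [coe_segmentMap]
      field_simp
      ring

theorem isEmbedding_segmentMap {p q : Icc (0 : ℝ) 1} (h : p ≠ q) :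
    IsEmbedding (𝓡∂ 1) (𝓡∂ 1) (segmentMap p q) := by
  have hne : (q : ℝ) - p ≠ 0 := sub_ne_zero.mpr fun e => h (Subtype.ext e.symm)
  refine isEmbedding_iff.mpr ⟨fun s t hst => ?_, fun t => ?_⟩
  · have h1 : (1 - (s : ℝ)) * p + s * q = (1 - t) * p + t * q := congrArg Subtype.val hst
    exact Subtype.ext (mul_right_cancel₀ hne (by linear_combination h1))
  · have hs : ContDiff ℝ ∞ fun s : ℝ => (1 - s) * p + s * q := by fun_prop
    have hd : HasDerivAt (fun s : ℝ => (1 - s) * p + s * q) (q - p) (t : ℝ) := by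
      have := (((hasDerivAt_id (t : ℝ)).const_sub 1).mul_const (p : ℝ)).add
        ((hasDerivAt_id (t : ℝ)).mul_const (q : ℝ))
      exact this.congr_deriv (by ring)
    have himm := immersiveAt_comp_val hs t hd hne
    refine ImmersiveAt.of_comp (g := fun s : Icc (0 : ℝ) 1 => (s : ℝ)) himm
      (contMDiff_subtypeVal_Icc _) ?_
    exact contMDiff_iff_comp_subtypeVal_Icc.mpr
      ⟨by unfold segmentMap; fun_prop, hs.contMDiff.comp contMDiff_subtypeVal_Icc⟩ t

/-- The arc of the circle that starts at the angle `a` and has length `π`. -/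
def halfCircle (a : ℝ) (t : Icc (0 : ℝ) 1) : Circle := Circle.exp (a + Real.pi * t)

theorem isEmbedding_halfCircle (a : ℝ) : IsEmbedding (𝓡∂ 1) (𝓡∂ 1) (halfCircle a) := by
  have hpi := Real.pi_pos
  have := finrank_real_complex_fact'
  have hcoe : ContMDiff (𝓡∂ 1) 𝓘(ℝ, ℂ) ∞ (fun w : Circle => (w : ℂ)) :=
    (contMDiff_coe_sphere (E := ℂ)).comp circle_compatible.2
  refine isEmbedding_iff.mpr ⟨fun s t hst => ?_, fun t => ?_⟩
  · obtain ⟨m, hm⟩ := Circle.exp_eq_exp.mp hst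
    have h1 : (s : ℝ) - t = 2 * m := by
      apply mul_left_cancel₀ hpi.ne'
      linear_combination hm
    -- `s - t` is an even integer of absolute value at most one
    have h2 : m = 0 := by
      have hlt : m < 1 := by
        have : (m : ℝ) < 1 := by linarith [s.2.2, t.2.1]
        exact_mod_cast this
      have hgt : -1 < m := by
        have : (-1 : ℝ) < m := by linarith [s.2.1, t.2.2]
        exact_mod_cast this
      omega
    rw [h2] at h1
    exact Subtype.ext (by simpa [sub_eq_zero] using h1)
  · have hg : ContDiff ℝ ∞ fun s : ℝ =>
        Complex.exp (((a + Real.pi * s : ℝ) : ℂ) * Complex.I) := by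
      have h0 : ContDiff ℝ ∞ fun s : ℝ => a + Real.pi * s := by fun_prop
      exact ((Complex.ofRealCLM.contDiff.comp h0).mul contDiff_const).cexp
    have hd : HasDerivAt (fun s : ℝ => Complex.exp (((a + Real.pi * s : ℝ) : ℂ) * Complex.I))
        (Complex.exp (((a + Real.pi * t : ℝ) : ℂ) * Complex.I) * ((Real.pi : ℂ) * Complex.I))
        (t : ℝ) := by
      have h0 : HasDerivAt (fun s : ℝ => a + Real.pi * s) Real.pi (t : ℝ) := by
        simpa using ((hasDerivAt_id (t : ℝ)).const_mul Real.pi).const_add a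
      exact (h0.ofReal_comp.mul_const Complex.I).cexp
    have himm := immersiveAt_comp_val hg t hd
      (mul_ne_zero (Complex.exp_ne_zero _)
        (mul_ne_zero (by exact_mod_cast hpi.ne') Complex.I_ne_zero))
    refine ImmersiveAt.of_comp (g := fun w : Circle => (w : ℂ)) (f := halfCircle a)
      (himm.congr (Filter.Eventually.of_forall fun s => Circle.coe_exp _)) (hcoe _) ?_
    have h0 : ContDiff ℝ ∞ fun s : ℝ => a + Real.pi * s := by fun_prop
    exact (circle_compatible.1.comp (contMDiff_circleExp.comp
      (h0.contMDiff.comp contMDiff_subtypeVal_Icc))) t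

theorem mem_range_halfCircle_zero {z : Circle} :
    z ∈ range (halfCircle 0) ↔ 0 ≤ (z : ℂ).im := by
  have hpi := Real.pi_pos
  constructor
  · rintro ⟨t, rfl⟩
    rw [halfCircle, zero_add, Circle.coe_exp, Complex.exp_ofReal_mul_I_im]
    exact Real.sin_nonneg_of_nonneg_of_le_pi (mul_nonneg hpi.le t.2.1)
      (mul_le_of_le_one_right hpi.le t.2.2)
  · intro h
    have h1 := Complex.arg_nonneg_iff.mpr h
    refine ⟨⟨Complex.arg z / Real.pi, by positivity,
      div_le_one_of_le₀ (Complex.arg_le_pi _) hpi.le⟩, ?_⟩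
    rw [halfCircle, zero_add, mul_div_cancel₀ _ hpi.ne', Circle.exp_arg]

theorem mem_range_halfCircle_pi {z : Circle} :
    z ∈ range (halfCircle Real.pi) ↔ (z : ℂ).im ≤ 0 := by
  have h1 : ∀ t, halfCircle Real.pi t = halfCircle 0 t * Circle.exp Real.pi := fun t => by
    rw [halfCircle, halfCircle, ← Circle.exp_add]
    congr 1
    ring
  have h2 : Circle.exp Real.pi * Circle.exp Real.pi = 1 := by
    rw [← Circle.exp_add, ← two_mul, Circle.exp_two_pi]
  have h3 : ((z * Circle.exp Real.pi : Circle) : ℂ).im = -(z : ℂ).im := by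
    rw [Circle.coe_mul, Circle.coe_exp, Complex.exp_pi_mul_I, mul_neg_one, Complex.neg_im]
  rw [← neg_nonneg, ← h3, ← mem_range_halfCircle_zero]
  constructor
  · rintro ⟨t, rfl⟩
    exact ⟨t, by rw [h1, mul_assoc, h2, mul_one]⟩
  · rintro ⟨t, ht⟩
    exact ⟨t, by rw [h1, ht, mul_assoc, h2, mul_one]⟩

end Curves

/-! ### Cups and caps -/

namespace Bordism

variable {n : ℕ}

/-- The bordism obtained from `W` by identifying its incoming boundary with another manifold. -/
def precomp {M M' N : ClosedManifold n} (W : Bordism M N) (f : CompactManifold.Diffeo M' M) :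
    Bordism M' N where
  toCompactManifold := W.toCompactManifold
  inMap := W.inMap ∘ f
  outMap := W.outMap
  isEmbedding_inMap := W.isEmbedding_inMap.comp (isEmbedding_diffeomorph f)
  isEmbedding_outMap := W.isEmbedding_outMap
  disjoint := by
    rw [EquivLike.range_comp]
    exact W.disjoint
  boundary_eq := by
    rw [EquivLike.range_comp]
    exact W.boundary_eq

theorem isEmbedding_prodMk {M : ClosedManifold n} (t : Icc (0 : ℝ) 1) :
    IsEmbedding (𝓡 n) (halfSpaceModel n) fun x : M => (x, t) :=
  .of_leftInverse (contMDiff_id.prodMk contMDiff_const) contMDiff_fst fun _ => rfl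

theorem isEmbedding_ends (M : ClosedManifold n) :
    IsEmbedding (𝓡 n) (halfSpaceModel n)
      (Sum.elim (fun x : M => (x, (0 : Icc (0 : ℝ) 1))) fun x : M => (x, (1 : Icc (0 : ℝ) 1))) := by
  refine (isEmbedding_prodMk 0).sumElim (isEmbedding_prodMk 1) ?_
  rw [Set.disjoint_left]
  rintro _ ⟨x, rfl⟩ ⟨y, hy⟩
  exact one_ne_zero (congrArg Prod.snd hy)

theorem boundary_prod_Icc (M : ClosedManifold n) :
    (halfSpaceModel n).boundary (M × Icc (0 : ℝ) 1) =
      range (Sum.elim (fun x : M => (x, (0 : Icc (0 : ℝ) 1)))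
        fun x : M => (x, (1 : Icc (0 : ℝ) 1))) := by
  rw [boundary_product]
  ext ⟨x, t⟩
  constructor
  · rintro ⟨-, rfl | rfl⟩
    · exact ⟨Sum.inl x, rfl⟩
    · exact ⟨Sum.inr x, rfl⟩
  · rintro ⟨y | y, hy⟩
    · exact ⟨trivial, Or.inl (congrArg Prod.snd hy).symm⟩
    · exact ⟨trivial, Or.inr (congrArg Prod.snd hy).symm⟩

/-- The cylinder `M × [0, 1]`, with both ends incoming. -/
def cap (M : ClosedManifold n) : Bordism (M.sum M) (emptyManifold n) where
  carrier := M × Icc (0 : ℝ) 1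
  orientable := isOrientable_prod M.orientable isOrientable_Icc
  inMap := Sum.elim (fun x : M => (x, 0)) fun x : M => (x, 1)
  outMap := isEmptyElim
  isEmbedding_inMap := isEmbedding_ends M
  isEmbedding_outMap := .of_isEmpty _
  disjoint := by simp [range_eq_empty]
  boundary_eq := (boundary_prod_Icc M).trans (by
    rw [range_eq_empty (isEmptyElim : emptyManifold n → M × Icc (0 : ℝ) 1)]
    exact (union_empty _).symm)

/-- The cylinder `M × [0, 1]`, with both ends outgoing. -/
def cup (M : ClosedManifold n) : Bordism (emptyManifold n) (M.sum M) where
  carrier := M × Icc (0 : ℝ) 1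
  orientable := isOrientable_prod M.orientable isOrientable_Icc
  inMap := isEmptyElim
  outMap := Sum.elim (fun x : M => (x, 0)) fun x : M => (x, 1)
  isEmbedding_inMap := .of_isEmpty _
  isEmbedding_outMap := isEmbedding_ends M
  disjoint := by simp [range_eq_empty]
  boundary_eq := (boundary_prod_Icc M).trans (by
    rw [range_eq_empty (isEmptyElim : emptyManifold n → M × Icc (0 : ℝ) 1)]
    exact (empty_union _).symm)

/-! ### Collars of the incoming boundary -/

/-- The bordism `W` is the union of a collar of its incoming boundary, embedded by `c`, and of a copy
of `W`, embedded by `s`. In other words, `W` absorbs the cylinder over its source. -/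
def HasInCollar {M N : ClosedManifold n} (W : Bordism M N) : Prop :=
  ∃ (c : M × Icc (0 : ℝ) 1 → W.carrier) (s : W.carrier → W.carrier),
    IsEmbedding (halfSpaceModel n) (halfSpaceModel n) c ∧
    IsEmbedding (halfSpaceModel n) (halfSpaceModel n) s ∧
    (∀ x, c (x, 0) = W.inMap x) ∧
    (∀ x, c (x, 1) = s (W.inMap x)) ∧
    (∀ z, s (W.outMap z) = W.outMap z) ∧
    range c ∪ range s = univ ∧
    range c ∩ range s ⊆ range fun x => c (x, 1)

/-- Gluing a mapping cylinder to a collared bordism only changes the identification of the incoming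
boundary. -/
theorem HasInCollar.isGluing {M M' N : ClosedManifold n} {W : Bordism M N} (hW : W.HasInCollar)
    (f : CompactManifold.Diffeo M' M) : IsGluing (cylinder f) W (W.precomp f) := by
  obtain ⟨c, s, hc, hs, hc0, hc1, hs1, hu, hi⟩ := hW
  have hsurj : Function.Surjective (Prod.map f id : M' × Icc (0 : ℝ) 1 → M × Icc (0 : ℝ) 1) :=
    f.surjective.prodMap Function.surjective_id
  have hr : range (c ∘ Prod.map f id) = range c := hsurj.range_comp c
  have hout : ∀ y, (c ∘ Prod.map f id) ((cylinder f).outMap y) = c (y, 1) := fun y =>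
    congrArg (fun y => c (y, 1)) (f.apply_symm_apply y)
  refine ⟨c ∘ Prod.map f id, s, hc.comp ((isEmbedding_diffeomorph f).prodMap isEmbedding_id), hs,
    fun x => hc0 (f x), hs1, fun y => (hout y).trans (hc1 y), ?_, ?_⟩
  · exact (congrArg (· ∪ range s) hr).trans hu
  · refine (congrArg (· ∩ range s) hr).trans (Eq.trans ?_ (congrArg range (funext hout)).symm)
    refine hi.antisymm ?_
    rintro _ ⟨y, rfl⟩
    exact ⟨⟨_, rfl⟩, ⟨W.inMap y, (hc1 y).symm⟩⟩

section Ranges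

variable {A B L P Q : Type}

theorem range_sumProdElim_union_range_sumMap {c : A × L → P} {c' : B × L → Q} {s : P → P}
    {s' : Q → Q} (h : range c ∪ range s = univ) (h' : range c' ∪ range s' = univ) :
    range (sumProdElim (Sum.inl ∘ c) (Sum.inr ∘ c')) ∪ range (Sum.map s s') = univ := by
  rw [range_sumProdElim, eq_univ_iff_forall]
  rintro (x | x)
  · rcases eq_univ_iff_forall.mp h x with ⟨y, rfl⟩ | ⟨y, rfl⟩
    exacts [Or.inl (Or.inl ⟨y, rfl⟩), Or.inr ⟨Sum.inl y, rfl⟩]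
  · rcases eq_univ_iff_forall.mp h' x with ⟨y, rfl⟩ | ⟨y, rfl⟩
    exacts [Or.inl (Or.inr ⟨y, rfl⟩), Or.inr ⟨Sum.inr y, rfl⟩]

theorem range_sumProdElim_inter_range_sumMap {c : A × L → P} {c' : B × L → Q} {s : P → P}
    {s' : Q → Q} {l : L} (h : range c ∩ range s ⊆ range fun x => c (x, l))
    (h' : range c' ∩ range s' ⊆ range fun x => c' (x, l)) :
    range (sumProdElim (Sum.inl ∘ c) (Sum.inr ∘ c')) ∩ range (Sum.map s s') ⊆
      range fun x => sumProdElim (Sum.inl ∘ c) (Sum.inr ∘ c') (x, l) := by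
  rw [range_sumProdElim]
  rintro _ ⟨⟨y, rfl⟩ | ⟨y, rfl⟩, z | z, hz⟩
  · obtain ⟨x, hx⟩ := h ⟨⟨y, rfl⟩, z, Sum.inl_injective hz⟩
    exact ⟨Sum.inl x, congrArg Sum.inl hx⟩
  · exact (Sum.inr_ne_inl hz).elim
  · exact (Sum.inl_ne_inr hz).elim
  · obtain ⟨x, hx⟩ := h' ⟨⟨y, rfl⟩, z, Sum.inr_injective hz⟩
    exact ⟨Sum.inr x, congrArg Sum.inr hx⟩

theorem range_prodMap_segmentMap {ι : A → B} (hι : Function.Surjective ι)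
    {a b : Icc (0 : ℝ) 1} : range (Prod.map ι (segmentMap a b)) = Prod.snd ⁻¹' uIcc a b := by
  rw [range_prodMap, hι.range_eq, range_segmentMap, univ_prod]

theorem range_prodMk {ι : A → B} (hι : Function.Surjective ι) (l : L) :
    range (fun x => (ι x, l)) = Prod.snd ⁻¹' {l} := by
  ext ⟨b, t⟩
  obtain ⟨a, rfl⟩ := hι b
  simp [eq_comm]

end Ranges

theorem HasInCollar.sum {M M' N N' : ClosedManifold n} {W : Bordism M N} {W' : Bordism M' N'}
    (hW : W.HasInCollar) (hW' : W'.HasInCollar) : (W.sum W').HasInCollar := by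
  obtain ⟨c, s, hc, hs, hc0, hc1, hs1, hu, hi⟩ := hW
  obtain ⟨c', s', hc', hs', hc0', hc1', hs1', hu', hi'⟩ := hW'
  refine ⟨sumProdElim (Sum.inl ∘ c) (Sum.inr ∘ c'), Sum.map s s', ?_, hs.sumMap hs', ?_, ?_, ?_,
    range_sumProdElim_union_range_sumMap hu hu', range_sumProdElim_inter_range_sumMap hi hi'⟩
  · refine (isEmbedding_inl.comp hc).sumProdElim (isEmbedding_inr.comp hc') ?_
    rw [Set.disjoint_left]
    rintro _ ⟨x, rfl⟩ ⟨y, hy⟩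
    exact Sum.inr_ne_inl hy
  · rintro (x | x)
    exacts [congrArg Sum.inl (hc0 x), congrArg Sum.inr (hc0' x)]
  · rintro (x | x)
    exacts [congrArg Sum.inl (hc1 x), congrArg Sum.inr (hc1' x)]
  · rintro (x | x)
    exacts [congrArg Sum.inl (hs1 x), congrArg Sum.inr (hs1' x)]

section Intervals

theorem exists_between_zero_one : ∃ p q r : Icc (0 : ℝ) 1, 0 < p ∧ p < q ∧ q < r ∧ r < 1 := by
  obtain ⟨p, hp, hp1⟩ := exists_between (zero_lt_one (α := Icc (0 : ℝ) 1))
  obtain ⟨q, hq, hq1⟩ := exists_between hp1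
  obtain ⟨r, hr, hr1⟩ := exists_between hq1
  exact ⟨p, q, r, hp, hq, hr, hr1⟩

variable {p q r : Icc (0 : ℝ) 1}

theorem uIcc_two_union : uIcc 0 p ∪ uIcc p 1 = univ := by
  refine eq_univ_iff_forall.mpr fun t => ?_
  rw [uIcc_of_le unitInterval.nonneg', uIcc_of_le unitInterval.le_one']
  exact (le_total t p).imp (fun h => ⟨t.2.1, h⟩) fun h => ⟨h, t.2.2⟩

theorem uIcc_two_inter : uIcc 0 p ∩ uIcc p 1 = {p} := by
  rw [uIcc_of_le unitInterval.nonneg', uIcc_of_le unitInterval.le_one',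
    Icc_inter_Icc_eq_singleton unitInterval.nonneg' unitInterval.le_one']

theorem uIcc_three_union (hpq : p < q) : uIcc 0 p ∪ uIcc 1 q ∪ uIcc p q = univ := by
  refine eq_univ_iff_forall.mpr fun t => ?_
  rw [uIcc_of_le unitInterval.nonneg', uIcc_of_ge unitInterval.le_one', uIcc_of_le hpq.le]
  have h0 : 0 ≤ t := t.2.1
  have h1 : t ≤ 1 := t.2.2
  grind

theorem uIcc_three_inter (hpq : p < q) : (uIcc 0 p ∪ uIcc 1 q) ∩ uIcc p q = {p} ∪ {q} := by
  ext t
  rw [uIcc_of_le unitInterval.nonneg', uIcc_of_ge unitInterval.le_one', uIcc_of_le hpq.le]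
  have h0 : 0 ≤ t := t.2.1
  have h1 : t ≤ 1 := t.2.2
  grind

theorem uIcc_four_union (hpq : p < q) (hqr : q < r) :
    uIcc 0 p ∪ uIcc q r ∪ (uIcc p q ∪ uIcc r 1) = univ := by
  refine eq_univ_iff_forall.mpr fun t => ?_
  rw [uIcc_of_le unitInterval.nonneg', uIcc_of_le unitInterval.le_one', uIcc_of_le hpq.le,
    uIcc_of_le hqr.le]
  have h0 : 0 ≤ t := t.2.1
  have h1 : t ≤ 1 := t.2.2
  grind

theorem uIcc_four_inter (hpq : p < q) (hqr : q < r) :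
    (uIcc 0 p ∪ uIcc q r) ∩ (uIcc p q ∪ uIcc r 1) = {p} ∪ ({q} ∪ {r}) := by
  ext t
  rw [uIcc_of_le unitInterval.nonneg', uIcc_of_le unitInterval.le_one', uIcc_of_le hpq.le,
    uIcc_of_le hqr.le]
  have h0 : 0 ≤ p := p.2.1
  have h1 : r ≤ 1 := r.2.2
  grind

theorem disjoint_uIcc {a b c d : Icc (0 : ℝ) 1} (h : max a b < min c d) :
    Disjoint (uIcc a b) (uIcc c d) := by
  rw [Set.disjoint_left]
  exact fun t ht ht' => (ht.2.trans_lt h).not_ge ht'.1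

end Intervals

theorem hasInCollar_cylinder {M N : ClosedManifold n} (f : CompactManifold.Diffeo M N) :
    (cylinder f).HasInCollar := by
  obtain ⟨p, q, r, h0, hq, hr, h1⟩ := exists_between_zero_one
  replace h1 : p < 1 := hq.trans (hr.trans h1)
  have hs := Function.surjective_id (α := M)
  refine ⟨Prod.map id (segmentMap 0 p), Prod.map id (segmentMap p 1),
    isEmbedding_id.prodMap (isEmbedding_segmentMap h0.ne),
    isEmbedding_id.prodMap (isEmbedding_segmentMap h1.ne),
    fun x => Prod.ext rfl (segmentMap_zero _ _),
    fun x => Prod.ext rfl ((segmentMap_one _ _).trans (segmentMap_zero _ _).symm),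
    fun x => Prod.ext rfl (segmentMap_one _ _), ?_, ?_⟩
  · change range (Prod.map (id : M → M) _) ∪ range (Prod.map (id : M → M) _) = univ
    rw [range_prodMap_segmentMap hs, range_prodMap_segmentMap hs, ← preimage_union,
      uIcc_two_union, preimage_univ]
  · change range (Prod.map (id : M → M) _) ∩ range (Prod.map (id : M → M) _) ⊆
      range fun x : M => (x, segmentMap 0 p 1)
    rw [range_prodMap_segmentMap hs, range_prodMap_segmentMap hs, ← preimage_inter,
      uIcc_two_inter, segmentMap_one]
    exact (range_prodMk hs p).superset

/-- The collar of the cap consists of two slabs, one at each end of the cylinder; the second one is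
traversed downwards. -/
theorem hasInCollar_cap (M : ClosedManifold n) : (cap M).HasInCollar := by
  obtain ⟨p, q, r, h0, hpq, hr, h1⟩ := exists_between_zero_one
  replace h1 : q < 1 := hr.trans h1
  have hs := Function.surjective_id (α := M)
  refine ⟨sumProdElim (Prod.map id (segmentMap 0 p)) (Prod.map id (segmentMap 1 q)),
    Prod.map id (segmentMap p q), ?_,
    isEmbedding_id.prodMap (isEmbedding_segmentMap hpq.ne), ?_, ?_, fun x => isEmptyElim x, ?_, ?_⟩
  · refine (isEmbedding_id.prodMap (isEmbedding_segmentMap h0.ne)).sumProdElim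
      (isEmbedding_id.prodMap (isEmbedding_segmentMap h1.ne')) ?_
    rw [range_prodMap_segmentMap hs, range_prodMap_segmentMap hs]
    exact (disjoint_uIcc (by simp [*, hpq.trans h1])).preimage _
  · rintro (x | x)
    exacts [Prod.ext rfl (segmentMap_zero _ _), Prod.ext rfl (segmentMap_zero _ _)]
  · rintro (x | x)
    exacts [Prod.ext rfl ((segmentMap_one _ _).trans (segmentMap_zero _ _).symm),
      Prod.ext rfl ((segmentMap_one _ _).trans (segmentMap_one _ _).symm)]
  · change range (sumProdElim (Prod.map (id : M → M) _) (Prod.map (id : M → M) _)) ∪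
      range (Prod.map (id : M → M) _) = univ
    rw [range_sumProdElim, range_prodMap_segmentMap hs, range_prodMap_segmentMap hs,
      range_prodMap_segmentMap hs, ← preimage_union, ← preimage_union, uIcc_three_union hpq,
      preimage_univ]
  · change range (sumProdElim (Prod.map (id : M → M) _) (Prod.map (id : M → M) _)) ∩
      range (Prod.map (id : M → M) _) ⊆ range fun x : M ⊕ M => sumProdElim (Prod.map (id : M → M)
        (segmentMap 0 p)) (Prod.map (id : M → M) (segmentMap 1 q)) (x, 1)
    rw [range_sumProdElim, range_prodMap_segmentMap hs, range_prodMap_segmentMap hs,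
      range_prodMap_segmentMap hs, ← preimage_union, ← preimage_inter, uIcc_three_inter hpq]
    rintro ⟨x, t⟩ (rfl | rfl)
    exacts [⟨Sum.inl x, Prod.ext rfl (segmentMap_one _ _)⟩,
      ⟨Sum.inr x, Prod.ext rfl (segmentMap_one _ _)⟩]

/-! ### Gluing cylinders, cups and caps -/

theorem isGluing_cylinder_trans {M N P : ClosedManifold n} (f : CompactManifold.Diffeo M N)
    (g : CompactManifold.Diffeo N P) :
    IsGluing (cylinder f) (cylinder g) (cylinder (f.trans g)) := by
  obtain ⟨p, q, r, h0, hq, hr, h1⟩ := exists_between_zero_one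
  replace h1 : p < 1 := hq.trans (hr.trans h1)
  have hs := Function.surjective_id (α := M)
  have hf : Function.Surjective f.symm := f.symm.surjective
  refine ⟨Prod.map id (segmentMap 0 p), Prod.map f.symm (segmentMap p 1),
    isEmbedding_id.prodMap (isEmbedding_segmentMap h0.ne),
    (isEmbedding_diffeomorph f.symm).prodMap (isEmbedding_segmentMap h1.ne),
    fun x => Prod.ext rfl (segmentMap_zero _ _),
    fun x => Prod.ext rfl (segmentMap_one _ _),
    fun x => Prod.ext rfl ((segmentMap_one _ _).trans (segmentMap_zero _ _).symm), ?_, ?_⟩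
  · change range (Prod.map (id : M → M) _) ∪ range (Prod.map f.symm _) = univ
    rw [range_prodMap_segmentMap hs, range_prodMap_segmentMap hf, ← preimage_union,
      uIcc_two_union, preimage_univ]
  · change range (Prod.map (id : M → M) _) ∩ range (Prod.map f.symm _) =
      range fun y : N => (f.symm y, segmentMap 0 p 1)
    rw [range_prodMap_segmentMap hs, range_prodMap_segmentMap hf, ← preimage_inter,
      uIcc_two_inter, segmentMap_one, range_prodMk hf]

/-- Two cylinders, embedded as two slabs of a cylinder. -/
def slabs {A B : Type} (ι : A → B) (a b c d : Icc (0 : ℝ) 1) :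
    (A × Icc (0 : ℝ) 1) ⊕ (A × Icc (0 : ℝ) 1) → B × Icc (0 : ℝ) 1 :=
  Sum.elim (Prod.map ι (segmentMap a b)) (Prod.map ι (segmentMap c d))

theorem range_slabs {A B : Type} {ι : A → B} (hι : Function.Surjective ι)
    {a b c d : Icc (0 : ℝ) 1} :
    range (slabs ι a b c d) = Prod.snd ⁻¹' (uIcc a b ∪ uIcc c d) := by
  rw [slabs, Sum.elim_range, range_prodMap_segmentMap hι, range_prodMap_segmentMap hι,
    preimage_union]

theorem isEmbedding_slabs {M N : ClosedManifold n} {ι : M → N} (hι : IsEmbedding (𝓡 n) (𝓡 n) ι)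
    {a b c d : Icc (0 : ℝ) 1} (hab : a ≠ b) (hcd : c ≠ d) (h : Disjoint (uIcc a b) (uIcc c d)) :
    IsEmbedding (halfSpaceModel n) (halfSpaceModel n) (slabs ι a b c d) := by
  refine (hι.prodMap (isEmbedding_segmentMap hab)).sumElim
    (hι.prodMap (isEmbedding_segmentMap hcd)) ?_
  rw [range_prodMap, range_prodMap, range_segmentMap, range_segmentMap]
  exact Set.disjoint_prod.mpr (Or.inr h)

theorem range_threeLevels {A B : Type} {ι : A → B} (hι : Function.Surjective ι)
    (a b c : Icc (0 : ℝ) 1) :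
    range (Sum.elim (fun x => (ι x, a)) (Sum.elim (fun x => (ι x, b)) fun x => (ι x, c))) =
      Prod.snd ⁻¹' ({a} ∪ ({b} ∪ {c})) := by
  rw [Sum.elim_range, Sum.elim_range, range_prodMk hι, range_prodMk hι, range_prodMk hι,
    preimage_union, preimage_union]

/-- The zigzag made of a cup on the right and of a cap on the left is a cylinder over `M`, cut in
four slabs. -/
theorem isGluing_zigzag_left {M : ClosedManifold n}
    (h : CompactManifold.Diffeo (M.sum (emptyManifold n)) ((emptyManifold n).sum M))
    (hh : ∀ x : M, h.symm (Sum.inr x) = Sum.inl x) :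
    IsGluing ((cylinder M.refl).sum (cup M))
      (((cap M).sum (cylinder M.refl)).precomp (M.sumAssoc M M).symm) (cylinder h) := by
  obtain ⟨p, q, r, h0, hpq, hqr, h1⟩ := exists_between_zero_one
  let ι : M → M.sum (emptyManifold n) := Sum.inl
  have hι : IsEmbedding (𝓡 n) (𝓡 n) ι := isEmbedding_inl
  have hs : Function.Surjective ι := by
    rintro (x | x)
    exacts [⟨x, rfl⟩, isEmptyElim x]
  have hpr := hpq.trans hqr
  have hqt := hqr.trans h1
  have e1 := isEmbedding_slabs hι h0.ne hqr.ne (disjoint_uIcc (by simp [*]))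
  have e2 := isEmbedding_slabs hι hpq.ne h1.ne (disjoint_uIcc (by simp [*, hpr.trans h1]))
  refine ⟨slabs ι 0 p q r, slabs ι p q r 1, e1, e2, ?_, ?_, ?_, ?_, ?_⟩
  · rintro (x | x)
    exacts [Prod.ext rfl (segmentMap_zero _ _), isEmptyElim x]
  · rintro (x | x)
    exacts [isEmptyElim x, Prod.ext (hh x).symm (segmentMap_one _ _)]
  · rintro (x | x | x)
    · exact Prod.ext rfl ((segmentMap_one 0 p).trans (segmentMap_zero p q).symm)
    · exact Prod.ext rfl ((segmentMap_zero q r).trans (segmentMap_one p q).symm)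
    · exact Prod.ext rfl ((segmentMap_one q r).trans (segmentMap_zero r 1).symm)
  · change range (slabs ι 0 p q r) ∪ range (slabs ι p q r 1) = univ
    rw [range_slabs hs, range_slabs hs, ← preimage_union, uIcc_four_union hpq hqr, preimage_univ]
  · have hi : range (slabs ι 0 p q r) ∩ range (slabs ι p q r 1) = range
        (Sum.elim (fun x => (ι x, p)) (Sum.elim (fun x => (ι x, q)) fun x => (ι x, r))) := by
      rw [range_slabs hs, range_slabs hs, ← preimage_inter, uIcc_four_inter hpq hqr,
        range_threeLevels hs]
    refine hi.trans (congrArg range (funext ?_))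
    rintro (x | x | x)
    · exact Prod.ext rfl (segmentMap_one 0 p).symm
    · exact Prod.ext rfl (segmentMap_zero q r).symm
    · exact Prod.ext rfl (segmentMap_one q r).symm

/-- The zigzag made of a cup on the left and of a cap on the right is a cylinder over `M`, cut in
four slabs. The cup and the cap are embedded upside down. -/
theorem isGluing_zigzag_right {M : ClosedManifold n}
    (h : CompactManifold.Diffeo ((emptyManifold n).sum M) (M.sum (emptyManifold n)))
    (hh : ∀ x : M, h.symm (Sum.inl x) = Sum.inr x) :
    IsGluing ((cup M).sum (cylinder M.refl))
      (((cylinder M.refl).sum (cap M)).precomp (M.sumAssoc M M)) (cylinder h) := by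
  obtain ⟨p, q, r, h0, hpq, hqr, h1⟩ := exists_between_zero_one
  let ι : M → (emptyManifold n).sum M := Sum.inr
  have hι : IsEmbedding (𝓡 n) (𝓡 n) ι := isEmbedding_inr
  have hs : Function.Surjective ι := by
    rintro (x | x)
    exacts [isEmptyElim x, ⟨x, rfl⟩]
  have hpr := hpq.trans hqr
  have hqt := hqr.trans h1
  have e1 := isEmbedding_slabs hι hqr.ne' h0.ne (disjoint_uIcc (by simp [*])).symm
  have e2 := isEmbedding_slabs hι h1.ne hpq.ne' (disjoint_uIcc (by simp [*, hpr.trans h1])).symm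
  refine ⟨slabs ι r q 0 p, slabs ι r 1 q p, e1, e2, ?_, ?_, ?_, ?_, ?_⟩
  · rintro (x | x)
    exacts [isEmptyElim x, Prod.ext rfl (segmentMap_zero _ _)]
  · rintro (x | x)
    exacts [Prod.ext (hh x).symm (segmentMap_one _ _), isEmptyElim x]
  · rintro ((x | x) | x)
    · exact Prod.ext rfl ((segmentMap_zero r q).trans (segmentMap_zero r 1).symm)
    · exact Prod.ext rfl ((segmentMap_one r q).trans (segmentMap_zero q p).symm)
    · exact Prod.ext rfl ((segmentMap_one 0 p).trans (segmentMap_one q p).symm)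
  · change range (slabs ι r q 0 p) ∪ range (slabs ι r 1 q p) = univ
    rw [range_slabs hs, range_slabs hs, ← preimage_union, uIcc_comm r q, uIcc_comm q p,
      union_comm (uIcc q r), union_comm (uIcc r 1), uIcc_four_union hpq hqr, preimage_univ]
  · have hi : range (slabs ι r q 0 p) ∩ range (slabs ι r 1 q p) = range
        (Sum.elim (fun x => (ι x, p)) (Sum.elim (fun x => (ι x, q)) fun x => (ι x, r))) := by
      rw [range_slabs hs, range_slabs hs, ← preimage_inter, uIcc_comm r q, uIcc_comm q p,
        union_comm (uIcc q r), union_comm (uIcc r 1), uIcc_four_inter hpq hqr,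
        range_threeLevels hs]
    refine hi.trans ?_
    -- the middle level lists the three copies of `M` in the reverse order
    refine (EquivLike.range_comp _ ((Equiv.sumComm (M ⊕ M) M).trans
      ((Equiv.refl M).sumCongr (Equiv.sumComm M M)))).symm.trans (congrArg range (funext ?_))
    rintro ((x | x) | x)
    · exact Prod.ext rfl (segmentMap_zero r q).symm
    · exact Prod.ext rfl (segmentMap_one r q).symm
    · exact Prod.ext rfl (segmentMap_one 0 p).symm

/-- The product `M × S¹` is the union of the two cylinders over the half circles. -/
theorem isGluing_cup_cap (M : ClosedManifold n) :
    IsGluing (cup M) ((cap M).precomp (M.sumComm M)) (timesCircle M).toBordism := by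
  have hs := Function.surjective_id (α := M)
  have hr : ∀ a, range (Prod.map (id : M → M) (halfCircle a)) =
      Prod.snd ⁻¹' range (halfCircle a) := fun a => by
    rw [range_prodMap, hs.range_eq, univ_prod]
  have h0 : halfCircle 0 0 = 1 := by simp [halfCircle]
  have h1 : halfCircle 0 1 = Circle.exp Real.pi := by simp [halfCircle]
  have h2 : halfCircle Real.pi 0 = Circle.exp Real.pi := by simp [halfCircle]
  have h3 : halfCircle Real.pi 1 = 1 := by
    rw [halfCircle, Icc.coe_one, mul_one, ← two_mul, Circle.exp_two_pi]
  refine ⟨Prod.map id (halfCircle 0), Prod.map id (halfCircle Real.pi),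
    isEmbedding_id.prodMap (isEmbedding_halfCircle 0),
    isEmbedding_id.prodMap (isEmbedding_halfCircle Real.pi),
    fun x => isEmptyElim x, fun x => isEmptyElim x, ?_, ?_, ?_⟩
  · rintro (x | x)
    exacts [Prod.ext rfl (h0.trans h3.symm), Prod.ext rfl (h1.trans h2.symm)]
  · change range (Prod.map (id : M → M) _) ∪ range (Prod.map (id : M → M) _) = univ
    rw [hr, hr, ← preimage_union]
    refine eq_univ_iff_forall.mpr fun z => ?_
    rw [mem_preimage, mem_union, mem_range_halfCircle_zero, mem_range_halfCircle_pi]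
    exact le_total _ _
  · have hi : range (Prod.map (id : M → M) (halfCircle 0)) ∩
        range (Prod.map (id : M → M) (halfCircle Real.pi)) =
        range (Sum.elim (fun x : M => (x, (1 : Circle))) fun x : M => (x, Circle.exp Real.pi)) := by
      rw [hr, hr, ← preimage_inter]
      ext ⟨x, z⟩
      rw [mem_preimage, mem_inter_iff, mem_range_halfCircle_zero, mem_range_halfCircle_pi]
      constructor
      · rintro ⟨ha, hb⟩
        have him := le_antisymm hb ha
        rcases le_or_gt 0 (z : ℂ).re with hre | hre
        · have h := Complex.arg_eq_zero_iff.mpr ⟨hre, him⟩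
          exact ⟨Sum.inl x, Prod.ext rfl (by rw [← Circle.exp_arg z, h]; simp)⟩
        · have h := Complex.arg_eq_pi_iff.mpr ⟨hre, him⟩
          exact ⟨Sum.inr x, Prod.ext rfl (by rw [← Circle.exp_arg z, h]; simp)⟩
      · rintro ⟨y | y, hy⟩
        · obtain rfl : 1 = z := congrArg Prod.snd hy
          simp
        · obtain rfl : Circle.exp Real.pi = z := congrArg Prod.snd hy
          simp
    refine hi.trans (congrArg range (funext ?_))
    rintro (x | x)
    exacts [Prod.ext rfl h0.symm, Prod.ext rfl h1.symm]

end Bordism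

end Geometry

/-! ### Duality in the image of a TQFT -/

section Duality

open CategoryTheory MonoidalCategory

variable {C : Type u} [Category.{v} C] [MonoidalCategory C] [SymmetricCategory C]

/-- The Euler characteristic does not depend on the dual: the isomorphism between two duals
transforms one coevaluation, and one evaluation, into the other. -/
theorem eulerCharacteristic_eq (c c₁ c₂ : C) (e₁ : ExactPairing c₁ c) (e₂ : ExactPairing c₂ c) :
    @eulerCharacteristic C _ _ _ c c₁ e₁ = @eulerCharacteristic C _ _ _ c c₂ e₂ := by
  let φ : c₁ ⟶ c₂ := @leftAdjointMate C _ _ c c ⟨c₂⟩ ⟨c₁⟩ (𝟙 c)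
  have hη : e₁.coevaluation' ≫ φ ▷ c = e₂.coevaluation' := by
    have := @coevaluation_comp_leftAdjointMate C _ _ c c ⟨c₂⟩ ⟨c₁⟩ (𝟙 c)
    rw [whiskerLeft_id, Category.comp_id] at this
    exact this
  have hε : c ◁ φ ≫ e₂.evaluation' = e₁.evaluation' := by
    have := @leftAdjointMate_comp_evaluation C _ _ c c ⟨c₂⟩ ⟨c₁⟩ (𝟙 c)
    rw [id_whiskerRight, Category.id_comp] at this
    exact this
  change e₁.coevaluation' ≫ c₁ ◁ 𝟙 c ≫ (β_ c₁ c).hom ≫ e₁.evaluation' =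
    e₂.coevaluation' ≫ c₂ ◁ 𝟙 c ≫ (β_ c₂ c).hom ≫ e₂.evaluation'
  rw [whiskerLeft_id, whiskerLeft_id, Category.id_comp, Category.id_comp, ← hη, ← hε,
    Category.assoc, BraidedCategory.braiding_naturality_left_assoc]

namespace MonoidalTQFT

variable {n : ℕ} (Z : MonoidalTQFT n C)

theorem map_cylinder_trans {M N P : ClosedManifold n} (f : CompactManifold.Diffeo M N)
    (g : CompactManifold.Diffeo N P) : Z.map (Bordism.cylinder (f.trans g)) =
      Z.map (Bordism.cylinder f) ≫ Z.map (Bordism.cylinder g) :=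
  Z.map_glue (Bordism.isGluing_cylinder_trans f g)

theorem map_cylinder_comp_symm {M N : ClosedManifold n} (f : CompactManifold.Diffeo M N) :
    Z.map (Bordism.cylinder f) ≫ Z.map (Bordism.cylinder f.symm) = 𝟙 _ := by
  rw [← map_cylinder_trans, f.self_trans_symm]
  exact Z.map_id M

theorem map_cylinder_symm_comp {M N : ClosedManifold n} (f : CompactManifold.Diffeo M N) :
    Z.map (Bordism.cylinder f.symm) ≫ Z.map (Bordism.cylinder f) = 𝟙 _ := by
  rw [← map_cylinder_trans, f.symm_trans_self]
  exact Z.map_id N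

theorem map_precomp {M M' N : ClosedManifold n} {W : Bordism M N} (hW : W.HasInCollar)
    (f : CompactManifold.Diffeo M' M) :
    Z.map (W.precomp f) = Z.map (Bordism.cylinder f) ≫ Z.map W :=
  Z.map_glue (hW.isGluing f)

theorem map_zigzag_left (M : ClosedManifold n) :
    Z.map ((Bordism.cylinder M.refl).sum (Bordism.cup M)) ≫
      Z.map (Bordism.cylinder (M.sumAssoc M M).symm) ≫
      Z.map ((Bordism.cap M).sum (Bordism.cylinder M.refl)) ≫
      Z.map (Bordism.cylinder M.emptySum) = Z.map (Bordism.cylinder M.sumEmpty) := by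
  have h := Z.map_glue (Bordism.isGluing_zigzag_left (M.sumEmpty.trans M.emptySum.symm)
    fun x => rfl)
  rw [map_cylinder_trans, Z.map_precomp
    ((Bordism.hasInCollar_cap M).sum (Bordism.hasInCollar_cylinder _))] at h
  have h2 := congrArg (· ≫ Z.map (Bordism.cylinder M.emptySum)) h
  simp only [Category.assoc, map_cylinder_symm_comp, Category.comp_id] at h2
  exact h2.symm

theorem map_zigzag_right (M : ClosedManifold n) :
    Z.map ((Bordism.cup M).sum (Bordism.cylinder M.refl)) ≫
      Z.map (Bordism.cylinder (M.sumAssoc M M)) ≫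
      Z.map ((Bordism.cylinder M.refl).sum (Bordism.cap M)) ≫
      Z.map (Bordism.cylinder M.sumEmpty) = Z.map (Bordism.cylinder M.emptySum) := by
  have h := Z.map_glue (Bordism.isGluing_zigzag_right (M.emptySum.trans M.sumEmpty.symm)
    fun x => rfl)
  rw [map_cylinder_trans, Z.map_precomp
    ((Bordism.hasInCollar_cylinder _).sum (Bordism.hasInCollar_cap M))] at h
  have h2 := congrArg (· ≫ Z.map (Bordism.cylinder M.sumEmpty)) h
  simp only [Category.assoc, map_cylinder_symm_comp, Category.comp_id] at h2
  exact h2.symm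

theorem whiskerLeft_map (M : ClosedManifold n) {N P : ClosedManifold n} (W : Bordism N P) :
    Z.obj M ◁ Z.map W ≫ (Z.μ M P).hom =
      (Z.μ M N).hom ≫ Z.map ((Bordism.cylinder M.refl).sum W) := by
  rw [← Z.μ_natural, Z.map_id, id_tensorHom]

theorem map_whiskerRight (M : ClosedManifold n) {N P : ClosedManifold n} (W : Bordism N P) :
    Z.map W ▷ Z.obj M ≫ (Z.μ P M).hom =
      (Z.μ N M).hom ≫ Z.map (W.sum (Bordism.cylinder M.refl)) := by
  rw [← Z.μ_natural, Z.map_id, tensorHom_id]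

/-- The cup, as a coevaluation. -/
def coev (M : ClosedManifold n) : 𝟙_ C ⟶ Z.obj M ⊗ Z.obj M :=
  Z.ε.hom ≫ Z.map (Bordism.cup M) ≫ (Z.μ M M).inv

/-- The cap, as an evaluation. -/
def ev (M : ClosedManifold n) : Z.obj M ⊗ Z.obj M ⟶ 𝟙_ C :=
  (Z.μ M M).hom ≫ Z.map (Bordism.cap M) ≫ Z.ε.inv

/-- The triangle identity that is the image of the left zigzag: the compatibilities of `Z` turn the
associator of `C` into the mapping cylinder of the associativity of the disjoint union. -/
theorem coev_ev_left (M : ClosedManifold n) :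
    Z.obj M ◁ Z.coev M ≫ (α_ _ _ _).inv ≫ Z.ev M ▷ Z.obj M =
      (ρ_ (Z.obj M)).hom ≫ (λ_ (Z.obj M)).inv := by
  have hA : (α_ (Z.obj M) (Z.obj M) (Z.obj M)).inv ≫ (Z.μ M M).hom ▷ Z.obj M ≫
      (Z.μ (M.sum M) M).hom = Z.obj M ◁ (Z.μ M M).hom ≫ (Z.μ M (M.sum M)).hom ≫
        Z.map (Bordism.cylinder (M.sumAssoc M M).symm) := by
    have := congrArg (fun f => (α_ _ _ _).inv ≫ f ≫
      Z.map (Bordism.cylinder (M.sumAssoc M M).symm)) (Z.associativity M M M)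
    simpa only [Category.assoc, map_cylinder_comp_symm, Category.comp_id,
      Iso.inv_hom_id_assoc] using this
  rw [Iso.eq_comp_inv]
  calc _ = Z.obj M ◁ Z.ε.hom ≫ Z.obj M ◁ Z.map (Bordism.cup M) ≫ Z.obj M ◁ (Z.μ M M).inv ≫
        (α_ _ _ _).inv ≫ (Z.μ M M).hom ▷ Z.obj M ≫ Z.map (Bordism.cap M) ▷ Z.obj M ≫
          (Z.μ _ M).hom ≫ Z.map (Bordism.cylinder M.emptySum) := by
        rw [Z.left_unitality]
        simp [coev, ev]
    _ = Z.obj M ◁ Z.ε.hom ≫ Z.obj M ◁ Z.map (Bordism.cup M) ≫ (Z.μ M (M.sum M)).hom ≫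
        Z.map (Bordism.cylinder (M.sumAssoc M M).symm) ≫
        Z.map ((Bordism.cap M).sum (Bordism.cylinder M.refl)) ≫
        Z.map (Bordism.cylinder M.emptySum) := by
        rw [reassoc_of% Z.map_whiskerRight M (Bordism.cap M), reassoc_of% hA,
          whiskerLeft_inv_hom_assoc]
    _ = _ := by
        rw [reassoc_of% Z.whiskerLeft_map M (Bordism.cup M), Z.map_zigzag_left,
          Z.right_unitality]

theorem coev_ev_right (M : ClosedManifold n) :
    Z.coev M ▷ Z.obj M ≫ (α_ _ _ _).hom ≫ Z.obj M ◁ Z.ev M =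
      (λ_ (Z.obj M)).hom ≫ (ρ_ (Z.obj M)).inv := by
  rw [Iso.eq_comp_inv]
  calc _ = Z.ε.hom ▷ Z.obj M ≫ Z.map (Bordism.cup M) ▷ Z.obj M ≫ (Z.μ M M).inv ▷ Z.obj M ≫
        (α_ _ _ _).hom ≫ Z.obj M ◁ (Z.μ M M).hom ≫ Z.obj M ◁ Z.map (Bordism.cap M) ≫
          (Z.μ M _).hom ≫ Z.map (Bordism.cylinder M.sumEmpty) := by
        rw [Z.right_unitality]
        simp [coev, ev]
    _ = Z.ε.hom ▷ Z.obj M ≫ Z.map (Bordism.cup M) ▷ Z.obj M ≫ (Z.μ (M.sum M) M).hom ≫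
        Z.map (Bordism.cylinder (M.sumAssoc M M)) ≫
        Z.map ((Bordism.cylinder M.refl).sum (Bordism.cap M)) ≫
        Z.map (Bordism.cylinder M.sumEmpty) := by
        rw [reassoc_of% Z.whiskerLeft_map M (Bordism.cap M),
          ← reassoc_of% Z.associativity M M M, inv_hom_whiskerRight_assoc]
    _ = _ := by
        rw [reassoc_of% Z.map_whiskerRight M (Bordism.cup M), Z.map_zigzag_right,
          Z.left_unitality]

/-- The object `Z(M)` is its own dual, with the cup as coevaluation and the cap as evaluation. -/
@[reducible]
def exactPairing (M : ClosedManifold n) : ExactPairing (Z.obj M) (Z.obj M) where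
  coevaluation' := Z.coev M
  evaluation' := Z.ev M
  coevaluation_evaluation' := Z.coev_ev_left M
  evaluation_coevaluation' := Z.coev_ev_right M

/-- The symmetry of `C` in the Euler characteristic becomes the exchange of the two copies of `M`
between the cup and the cap. -/
theorem value_timesCircle (M : ClosedManifold n) (c' : C) [e : ExactPairing c' (Z.obj M)] :
    Z.value (timesCircle M) = eulerCharacteristic (Z.obj M) c' := by
  rw [eulerCharacteristic_eq (Z.obj M) c' (Z.obj M) e (Z.exactPairing M)]
  change _ = Z.coev M ≫ Z.obj M ◁ 𝟙 _ ≫ (β_ (Z.obj M) (Z.obj M)).hom ≫ Z.ev M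
  rw [whiskerLeft_id, Category.id_comp, value, Z.map_glue (Bordism.isGluing_cup_cap M),
    Z.map_precomp (Bordism.hasInCollar_cap M), coev, ev, ← reassoc_of% Z.braided M M]
  simp

end MonoidalTQFT

end Duality

/-! ### Euler characteristics of modules -/

section Idempotent

open Polynomial Matrix

variable {R : Type w} [CommRing R] {m : Type*} [Fintype m] [DecidableEq m]

theorem aeval_det_one_add_X_smul (E : Matrix m m R) {A : Type*} [CommRing A] [Algebra R A]
    (a : A) :
    aeval a (det (1 + (X : R[X]) • E.map C)) = det (1 + a • E.map (algebraMap R A)) := by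
  rw [AlgHom.map_det]
  congr 1
  ext i j
  simp [Matrix.one_apply, apply_ite (aeval a)]
  exact mul_comm _ _

/-- For an idempotent matrix `E`, the matrix `1 + (a - 1) E` acts by `a` on the range of `E` and by
`1` on its kernel, hence is multiplicative in `a`. -/
theorem det_one_add_sub_one_smul_mul {A : Type*} [CommRing A] {E : Matrix m m A}
    (hE : IsIdempotentElem E) (a b : A) :
    det (1 + (a - 1) • E) * det (1 + (b - 1) • E) = det (1 + (a * b - 1) • E) := by
  rw [← det_mul]
  congr 1
  have hE' : E * E = E := hE
  rw [mul_add, mul_one, add_mul, one_mul, smul_mul_smul_comm, hE', add_assoc, ← add_smul,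
    ← add_smul]
  congr 2
  ring

/-- The identity `φ(a) φ(b) = φ(a b)` for two independent variables, read off in degree `j` of the
second one. -/
theorem coeff_mul_of_multiplicative {φ : R[X]}
    (h : ∀ a b : R[X][X], aeval a φ * aeval b φ = aeval (a * b) φ) (j : ℕ) :
    φ * C (φ.coeff j) = C (φ.coeff j) * X ^ j := by
  have h1 := congrArg (fun p => coeff p j) (h (C X) X)
  have e1 : aeval (C X : R[X][X]) φ = C φ := by
    have := aeval_algHom_apply (CAlgHom (R := R) (A := R[X])) (X : R[X]) φ
    rwa [aeval_X_left_apply] at this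
  have e2 : aeval (X : R[X][X]) φ = φ.map C := rfl
  have e3 : ∀ ψ : R[X], coeff (aeval (C X * X : R[X][X]) ψ) j = C (ψ.coeff j) * X ^ j := by
    intro ψ
    induction ψ using Polynomial.induction_on' with
    | add p q hp hq => rw [map_add, coeff_add, hp, hq, coeff_add, C_add, add_mul]
    | monomial k r =>
      have hr : algebraMap R R[X][X] r = C (C r) := rfl
      rw [aeval_monomial, mul_pow, ← C_pow, ← mul_assoc, hr, ← C_mul, coeff_C_mul_X_pow,
        coeff_monomial]
      split_ifs with h1 h2 h2 <;> grind [C_0]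
  rw [e1, e2] at h1
  simp only [coeff_C_mul, coeff_map] at h1
  rw [h1, e3]

/-- The trace of an idempotent matrix over a ring without nontrivial idempotents is a natural
number: the polynomial `φ(a) = det (1 + (a - 1) E)` satisfies `φ(a) φ(b) = φ(a b)`, so that its
coefficients are orthogonal idempotents of sum `φ(1) = 1`. It is therefore a power `X ^ k`, and the
trace of `E` is the derivative `φ'(1) = k`. -/
theorem exists_trace_eq_natCast (hR : ∀ e : R, IsIdempotentElem e → e = 0 ∨ e = 1)
    {E : Matrix m m R} (hE : IsIdempotentElem E) : ∃ k : ℕ, E.trace = k := by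
  nontriviality R
  set q : R[X] := det (1 + (X : R[X]) • E.map C) with hq
  set φ : R[X] := q.comp (X - 1) with hφ
  have haeval : ∀ a : R[X][X], aeval a φ =
      det (1 + (a - 1) • E.map (algebraMap R R[X][X])) := fun a => by
    rw [hφ, aeval_comp, hq, aeval_det_one_add_X_smul]
    simp
  have hEA : IsIdempotentElem (E.map (algebraMap R R[X][X])) := by
    rw [IsIdempotentElem, ← Matrix.map_mul, hE.eq]
  have hφj := coeff_mul_of_multiplicative (φ := φ) fun a b => by
    rw [haeval, haeval, haeval, det_one_add_sub_one_smul_mul hEA]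
  have hid : ∀ j, IsIdempotentElem (φ.coeff j) := fun j => by
    have := congrArg (fun p => coeff p j) (hφj j)
    simpa [IsIdempotentElem] using this
  have h1 : φ.eval 1 = 1 := by
    rw [hφ, eval_comp, hq, eval_det]
    simp
  obtain ⟨k, hk⟩ : ∃ k, φ.coeff k = 1 := by
    by_contra! hne
    have : φ = 0 := by
      ext j
      exact (hR _ (hid j)).resolve_right (hne j)
    rw [this, eval_zero] at h1
    exact zero_ne_one h1
  have hφk : φ = X ^ k := by simpa [hk] using hφj k
  have hqk : q = (X + 1) ^ k := by
    have : φ.comp (X + 1) = q := by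
      rw [hφ, comp_assoc]
      simp
    rw [← this, hφk]
    simp
  refine ⟨k, ?_⟩
  rw [← derivative_det_one_add_X_smul, ← hq, hqk]
  simp [derivative_pow]

end Idempotent

section Modules

open CategoryTheory MonoidalCategory TensorProduct

variable {R : Type w} [CommRing R]

/-- The Euler characteristic of a dualizable module over a ring without nontrivial idempotents is
the multiplication by a natural number. -/
theorem exists_eulerCharacteristic_eq (hR : ∀ e : R, IsIdempotentElem e → e = 0 ∨ e = 1)
    (P P' : ModuleCat.{w} R) [ExactPairing P' P] :
    ∃ k : ℕ, eulerCharacteristic P P' = scalarEmbedding R (k : R) := by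
  -- the evaluation as a bilinear form, and the coevaluation as a finite sum of tensors
  let b : P →ₗ[R] P' →ₗ[R] R := TensorProduct.curry (ε_ P' P).hom
  obtain ⟨S, hS⟩ := TensorProduct.exists_finset ((η_ P' P).hom (1 : R))
  -- the triangle identity says that the tensors in `S` form a dual basis
  have hp : ∀ p : P, ∑ i ∈ S, b p i.1 • i.2 = p := fun p => by
    have h := congrArg (fun f => (f ≫ (λ_ P).hom).hom (p ⊗ₜ (1 : R)))
      (ExactPairing.coevaluation_evaluation P' P)
    simp only [Category.assoc, Iso.inv_hom_id, Category.comp_id] at h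
    -- the linear maps below are the components of the composition in `h`
    have h1 : TensorProduct.lid R P ((ε_ P' P).hom.rTensor P
        ((TensorProduct.assoc R P P' P).symm (p ⊗ₜ[R] (η_ P' P).hom (1 : R)))) = (1 : R) • p := h
    rw [one_smul] at h1
    conv_rhs => rw [← h1, hS]
    rw [tmul_sum, map_sum, map_sum, map_sum]
    rfl
  have htr : (eulerCharacteristic P P').hom (1 : R) = ∑ i ∈ S, b i.2 i.1 := by
    have h1 : (eulerCharacteristic P P').hom (1 : R) =
        (ε_ P' P).hom (TensorProduct.comm R P' P ((η_ P' P).hom (1 : R))) := by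
      rw [eulerCharacteristic, trace, whiskerLeft_id, Category.id_comp]
      rfl
    rw [h1, hS, map_sum]
    exact map_sum (ε_ P' P).hom _ _
  classical
  obtain ⟨k, hk⟩ := exists_trace_eq_natCast hR
    (E := Matrix.of fun i j : S => b i.1.2 j.1.1) (by
      ext i j
      rw [Matrix.mul_apply]
      simp only [Matrix.of_apply]
      conv_rhs => rw [← hp i.1.2]
      rw [map_sum, LinearMap.sum_apply, ← Finset.sum_coe_sort S]
      simp)
  refine ⟨k, ?_⟩
  ext
  refine htr.trans ?_
  rw [← Finset.sum_coe_sort S]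
  exact hk.trans (mul_one _).symm

end Modules

end Bord

end

open CategoryTheory MonoidalCategory in
/-- Part one: for every monoidal TQFT `Z` and every closed orientable manifold `M`, the object `Z(M)`
is dualizable and `Z(M × S¹)` is its Euler characteristic. Part two: an invariant with values in
a commutative ring `R` without nontrivial idempotents whose value at some `M × S¹` is not in the
subring of integers of `R` is not strongly quantizable. -/
theorem mainTheorem5 (n : ℕ) :
    (∀ (C : Type u) [Category.{v} C] [MonoidalCategory C] [SymmetricCategory C]
      (Z : Bord.MonoidalTQFT n C) (M : Bord.ClosedManifold n),
      (∃ c' : C, Nonempty (ExactPairing c' (Z.obj M))) ∧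
      ∀ (c' : C) [ExactPairing c' (Z.obj M)],
        Z.value (Bord.timesCircle M) = Bord.eulerCharacteristic (Z.obj M) c') ∧
    (∀ (R : Type w) [CommRing R], (∀ e : R, IsIdempotentElem e → e = 0 ∨ e = 1) →
      ∀ χ : Bord.DiffeoInvariant n R,
        (∃ M : Bord.ClosedManifold n, χ (Bord.timesCircle M) ∉ Subring.closure {(1 : R)}) →
        ¬ Bord.StronglyQuantizable χ) := by
  refine ⟨fun C _ _ _ Z M => ⟨⟨Z.obj M, ⟨Z.exactPairing M⟩⟩, fun c' _ =>
    Z.value_timesCircle M c'⟩, ?_⟩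
  rintro R _ hR χ ⟨M, hM⟩ ⟨Z, hZ⟩
  let := Z.exactPairing M
  obtain ⟨k, hk⟩ := Bord.exists_eulerCharacteristic_eq hR (Z.obj M) (Z.obj M)
  have h : χ (Bord.timesCircle M) = k := (Bord.scalarEmbedding R).injective
    ((hZ _).symm.trans ((Z.value_timesCircle M (Z.obj M)).trans hk))
  exact hM (h ▸ natCast_mem _ k)
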